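/- Let $\sigma(p)=p^3-p$, let $\mu\neq 0$ be a real number, and let $p_0\in X_1:=\{q\in L^2(0,1):\int_0^1 q\,dx=\mu\}$. Consider the problem $$p_t(x,t)=-\sigma(p(x,t))+\int_0^1\sigma(p(y,t))\,dy,\qquad x\in(0,1),\ t>0,\qquad p(\cdot,0)=p_0. \tag{1}$$ A solution of (1) is a function $p=p(x,t)$ on $(0,1)\times[0,\infty)$ such that (i) $p\in C([0,\infty);L^2(0,1))$ and $p(\cdot,0)=p_0$; (ii) $\sigma(p(\cdot,t))\in L^1(0,1)$ for a.e. $t\ge 0$, and, for a.e. $x\in(0,1)$, $\sigma(p(x,\cdot))-\int_0^1\sigma(p(y,\cdot))\,dy\in L^1(\tau,T)$ for all $0<\tau<T<\infty$; (iii) for a.e. $x\in(0,1)$, $\;p(x,t)=p(x,s)-\int_s^t\big(\sigma(p(x,\tau))-\int_0^1\sigma(p(y,\tau))\,dy\big)\,d\tau$ for all $s,t>0$. Then (1) has a solution $p$, and it is unique (if $q$ is another solution then, for a.e. $x\in(0,1)$, $q(x,t)=p(x,t)$ for all $t\ge 0$). Moreover there is an equilibrium solution $\bar p\in L^2(0,1)$,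 that is, a function with $\sigma(\bar p(x))=\int_0^1\sigma(\bar p(y))\,dy$ for a.e. $x\in(0,1)$ and $\int_0^1\bar p\,dx=\mu$, such that $$p(x,t)\to\bar p(x)\quad\text{as } t\to\infty,\ \text{for a.e. } x\in(0,1).$$ -/

import Mathlib

open MeasureTheory Filter Topology Set

noncomputable section

namespace Visco

/-- Lebesgue measure on the unit interval `(0,1)`. -/
def unitMeasure : Measure ℝ := volume.restrict (Ioo (0 : ℝ) 1)

/-- The stress `σ(p) = p³ - p`. -/
def cubicStress (p : ℝ) : ℝ := p ^ 3 - p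

/-- The data with prescribed mean: (representatives of) the functions `q ∈ L²(0,1)`
with `∫₀¹ q dx = μ`. -/
def dataSpace (μ : ℝ) : Set (ℝ → ℝ) :=
  {q | MemLp q 2 unitMeasure ∧ ∫ x, q x ∂unitMeasure = μ}

/-- `σ(p(x,t)) - ∫₀¹ σ(p(y,t)) dy`, that is, minus the right-hand side of the equation. -/
def netStress (σ : ℝ → ℝ) (p : ℝ → ℝ → ℝ) (x t : ℝ) : ℝ :=
  σ (p x t) - ∫ y, σ (p y t) ∂unitMeasure

/-- `p = p(x,t)` is a (global in time) solution of
`p_t(x,t) = -σ(p(x,t)) + ∫₀¹ σ(p(y,t)) dy` on `(0,1) × [0,∞)` with `p(·,0) = p₀`.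
Only the values of `p` at `x ∈ (0,1)` and `t ≥ 0` matter. -/
structure IsSolution (σ : ℝ → ℝ) (p₀ : ℝ → ℝ) (p : ℝ → ℝ → ℝ) : Prop where
  /-- `p(·,t) ∈ L²(0,1)` for all `t ≥ 0`. -/
  memLp : ∀ t, 0 ≤ t → MemLp (fun x => p x t) 2 unitMeasure
  /-- `t ↦ p(·,t)` is continuous from `[0,∞)` to `L²(0,1)`. -/
  continuous_L2 : ∀ t, 0 ≤ t →
    Tendsto (fun s => eLpNorm (fun x => p x s - p x t) 2 unitMeasure) (𝓝[Ici 0] t) (𝓝 0)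
  /-- `p(·,0) = p₀`. -/
  initial : ∀ᵐ x ∂unitMeasure, p x 0 = p₀ x
  /-- `σ(p(·,t)) ∈ L¹(0,1)` for a.e. `t ≥ 0`. -/
  stress_integrable : ∀ᵐ t ∂(volume.restrict (Ici (0 : ℝ))),
    Integrable (fun x => σ (p x t)) unitMeasure
  /-- `σ(p(x,·)) - ∫₀¹ σ(p(y,·)) dy ∈ L¹(τ,T)` for a.e. `x` and all `0 < τ < T`. -/
  netStress_integrable : ∀ᵐ x ∂unitMeasure, ∀ τ T : ℝ, 0 < τ → τ < T →
    IntegrableOn (fun s => netStress σ p x s) (Ioo τ T) volume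
  /-- The equation, integrated in time: for a.e. `x`, for all `s, t > 0`. -/
  equation : ∀ᵐ x ∂unitMeasure, ∀ s t : ℝ, 0 < s → 0 < t →
    p x t = p x s - ∫ τ in s..t, netStress σ p x τ

/-- `pbar ∈ L²(0,1)` is an equilibrium solution with mean `μ`:
`0 = -σ(pbar(x)) + ∫₀¹ σ(pbar(y)) dy` for a.e. `x`, and `∫₀¹ pbar dx = μ`. -/
structure IsEquilibrium (σ : ℝ → ℝ) (μ : ℝ) (pbar : ℝ → ℝ) : Prop where
  memLp : MemLp pbar 2 unitMeasure
  stress_integrable : Integrable (fun x => σ (pbar x)) unitMeasure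
  equation : ∀ᵐ x ∂unitMeasure, 0 = -σ (pbar x) + ∫ y, σ (pbar y) ∂unitMeasure
  mean : ∫ x, pbar x ∂unitMeasure = μ

end Visco

end

noncomputable section

namespace Visco

open scoped BoundedContinuousFunction NNReal

variable {α : Type*} [MeasurableSpace α]

/-! ### Elementary facts about the stress and about real functions -/

/-! Write `N(t)` for the mean of `σ(p(·,t))`.

Well-posedness rests on two estimates. First, `(a - b)(σ(a) - σ(b)) ≥ -(a - b)²`; as solutions with
equal means differ by a function of mean zero, the nonlocal terms drop out and the L² distance grows
at most like `exp t` (`IsClassical.eLpNorm_diff_le`). Second, the cubic growth of `σ` brings any two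
trajectories within `4 + 4 / t` of each other (`abs_sub_le_of_hasDerivAt`), so `|p| ≤ |μ| + 4 + 4 /
t` for all L² data. Bounded continuous data are treated by an ODE in a space of bounded continuous
functions, general data by approximation (`exists_isClassical`). Every solution is classical for `t
> 0` off a null set (`IsSolution.exists_isClassical`), so stability yields uniqueness.

For the asymptotics, the energy `∫ (p⁴/4 - p²/2)` decreases at the rate `∫ (σ(p) - N)²`. Hence
`σ(p(x,t)) - N(t) → 0` for a.e. `x` (`IsClassical.ae_tendsto_netStress`), and `∫ p² - μ N` has a
limit `K` (`IsClassical.exists_tendsto_second_moment`).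

The heart is the convergence of `N` (`mean_eq_zero_of_oscillation`). Suppose `N` keeps crossing an
interval of positive levels. During a late crossing a typical `p(x,·)` cannot vanish, since `σ(0) =
0` is far from `N`; so the measure of `{p > 0}` is asymptotically constant within a crossing. When
`N = σ(z)` with `z > 1`, this measure is close to `(μ z³ + z² + K - 1) / (3 z² - 1)`, which must
then be constant on an interval of `z`. A polynomial identity forces `μ = 0`. Negative levels follow
from oddness of `σ`. Once `N` converges, so does `σ(p(x,·))`, and then `p(x,·)`, because `σ` is
constant on no interval. -/

lemma continuous_cubicStress : Continuous cubicStress := by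
  unfold cubicStress; fun_prop

lemma hasDerivAt_cubicStress (x : ℝ) : HasDerivAt cubicStress (3 * x ^ 2 - 1) x := by
  unfold cubicStress
  simpa using (hasDerivAt_pow 3 x).fun_sub (hasDerivAt_id' x)

lemma cubicStress_neg (x : ℝ) : cubicStress (-x) = -cubicStress x := by
  unfold cubicStress; ring

/-- For `R ≥ 2` the value at `R` dominates the local maximum of the nonmonotone cubic: the cofactor
of `R - x` is at least `3R²/4 - 1`. Truncation at `±R` later relies on this. -/
lemma cubicStress_le_of_le {R x : ℝ} (hR : 2 ≤ R) (hx : x ≤ R) : cubicStress x ≤ cubicStress R := by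
  have h : cubicStress R - cubicStress x = (R - x) * (R ^ 2 + R * x + x ^ 2 - 1) := by
    unfold cubicStress; ring
  have h2 : 0 ≤ R ^ 2 + R * x + x ^ 2 - 1 := by nlinarith [sq_nonneg (R / 2 + x)]
  nlinarith [mul_nonneg (sub_nonneg.2 hx) h2]

lemma neg_sq_le_sub_mul_cubicStress_sub (a b : ℝ) :
    -(a - b) ^ 2 ≤ (a - b) * (cubicStress a - cubicStress b) := by
  have h : (a - b) * (cubicStress a - cubicStress b) + (a - b) ^ 2
      = (a - b) ^ 2 * (a ^ 2 + a * b + b ^ 2) := by unfold cubicStress; ring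
  have h2 : 0 ≤ a ^ 2 + a * b + b ^ 2 := by nlinarith [sq_nonneg (a / 2 + b), sq_nonneg a]
  nlinarith [mul_nonneg (sq_nonneg (a - b)) h2]

lemma exists_cubicStress_bound (C : ℝ) : ∃ B, 0 ≤ B ∧ ∀ x, |x| ≤ C → |cubicStress x| ≤ B := by
  obtain ⟨B, hB⟩ := (isCompact_Icc (a := -C) (b := C)).exists_bound_of_continuousOn
    continuous_cubicStress.continuousOn
  refine ⟨max B 0, le_max_right _ _, fun x hx => ?_⟩
  exact (hB x (abs_le.1 hx)).trans (le_max_left _ _)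

lemma exists_cubicStress_lipschitz (C : ℝ) : ∃ L, 0 ≤ L ∧ ∀ x y, |x| ≤ C → |y| ≤ C →
    |cubicStress x - cubicStress y| ≤ L * |x - y| := by
  refine ⟨3 * C ^ 2 + 1, by positivity, fun x y hx hy => ?_⟩
  have h : cubicStress x - cubicStress y = (x ^ 2 + x * y + y ^ 2 - 1) * (x - y) := by
    unfold cubicStress; ring
  rw [h, abs_mul]
  refine mul_le_mul_of_nonneg_right ?_ (abs_nonneg _)
  have hx2 : x ^ 2 ≤ C ^ 2 := sq_le_sq' (abs_le.1 hx).1 (abs_le.1 hx).2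
  have hy2 : y ^ 2 ≤ C ^ 2 := sq_le_sq' (abs_le.1 hy).1 (abs_le.1 hy).2
  rw [abs_le]
  constructor <;> nlinarith [sq_nonneg (x + y), sq_nonneg (x - y)]

/-- A function that starts nonpositive and cannot increase while positive stays nonpositive. -/
lemma nonpos_of_deriv_nonpos_of_pos {f f' : ℝ → ℝ} {a b : ℝ} (hab : a ≤ b)
    (hf : ContinuousOn f (Icc a b)) (hd : ∀ t ∈ Ioo a b, HasDerivAt f (f' t) t)
    (hpos : ∀ t ∈ Ioo a b, 0 < f t → f' t ≤ 0) (ha : f a ≤ 0) : f b ≤ 0 := by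
  by_contra! hb
  set S : Set ℝ := Icc a b ∩ f ⁻¹' Iic 0 with hS
  have hSc : IsCompact S :=
    isCompact_Icc.of_isClosed_subset (hf.preimage_isClosed_of_isClosed isClosed_Icc isClosed_Iic)
      inter_subset_left
  have hne : S.Nonempty := ⟨a, left_mem_Icc.2 hab, ha⟩
  obtain ⟨⟨hc1, hc2⟩, hc3⟩ := hSc.sSup_mem hne
  set c := sSup S
  have hgt : ∀ t ∈ Ioc c b, 0 < f t := by
    intro t ht
    by_contra! h
    exact absurd (le_csSup hSc.bddAbove (⟨⟨hc1.trans ht.1.le, ht.2⟩, h⟩ : t ∈ S)) (not_le.2 ht.1)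
  have hanti : AntitoneOn f (Icc c b) := by
    refine antitoneOn_of_deriv_nonpos (convex_Icc _ _) (hf.mono (Icc_subset_Icc_left hc1)) ?_ ?_
    · rw [interior_Icc]
      exact fun t ht => (hd t ⟨hc1.trans_lt ht.1, ht.2⟩).differentiableAt.differentiableWithinAt
    · rw [interior_Icc]
      intro t ht
      rw [(hd t ⟨hc1.trans_lt ht.1, ht.2⟩).deriv]
      exact hpos t ⟨hc1.trans_lt ht.1, ht.2⟩ (hgt t ⟨ht.1, ht.2.le⟩)
  have : f b ≤ f c := hanti (left_mem_Icc.2 hc2) (right_mem_Icc.2 hc2) hc2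
  have hc3' : f c ≤ 0 := hc3
  linarith

/-- Two trajectories driven by the same forcing come within a universal distance of each other,
whatever their initial distance. -/
lemma abs_sub_le_of_hasDerivAt {a b : ℝ → ℝ}
    (h : ∀ t, 0 < t →
      HasDerivAt (fun s => a s - b s) (cubicStress (b t) - cubicStress (a t)) t)
    {t : ℝ} (ht : 0 < t) : |a t - b t| ≤ 4 + 4 / t := by
  -- The weight `s - t/2` vanishes at `s = t/2`, so this function starts at `-2` whatever the
  -- initial distance; nonpositivity at `s = t` reads `(a - b)² ≤ 4 + 4 / t`.
  have hd : ∀ s, 0 < s → HasDerivAt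
      (fun s => (s - t / 2) * ((a s - b s) ^ 2 - 4) - 2)
      (((a s - b s) ^ 2 - 4) + (s - t / 2) *
        (2 * (a s - b s) * (cubicStress (b s) - cubicStress (a s)))) s := by
    intro s hs
    have h1 := ((hasDerivAt_id s).sub_const (t / 2)).mul (((h s hs).pow 2).sub_const 4)
    refine (h1.sub_const 2).congr_deriv ?_
    simp
  have key := nonpos_of_deriv_nonpos_of_pos (a := t / 2) (b := t) (by linarith)
    (fun s hs => (hd s (by linarith [hs.1])).continuousAt.continuousWithinAt)
    (fun s hs => hd s (by linarith [hs.1])) ?_ (by norm_num)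
  · have h2 : (a t - b t) ^ 2 ≤ 4 + 4 / t := by
      have h3 : t * ((a t - b t) ^ 2 - 4) ≤ 4 := by linarith
      have h4 : (a t - b t) ^ 2 - 4 ≤ 4 / t := by
        rw [le_div_iff₀ ht]; linarith
      linarith
    have h5 : 0 < 4 / t := by positivity
    rw [← sq_abs] at h2
    nlinarith [abs_nonneg (a t - b t)]
  · intro s hs hpos
    have hs' : 0 < s - t / 2 := by linarith [hs.1]
    set w := a s - b s with hw
    -- From `4(a² + ab + b²) = 3(a + b)² + w²`; so `u = w²` satisfies `u' ≤ -u(u - 4)/2`.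
    have h1 : 2 * w * (cubicStress (b s) - cubicStress (a s)) ≤ 2 * w ^ 2 - (w ^ 2) ^ 2 / 2 := by
      have : 2 * w ^ 2 - (w ^ 2) ^ 2 / 2 - 2 * w * (cubicStress (b s) - cubicStress (a s))
          = 3 / 2 * (w * (a s + b s)) ^ 2 := by
        rw [hw]; unfold cubicStress; ring
      nlinarith [sq_nonneg (w * (a s + b s))]
    set u := w ^ 2
    have hu : 0 < u - 4 := by
      by_contra! hcon
      nlinarith
    have h3 : (s - t / 2) * (2 * w * (cubicStress (b s) - cubicStress (a s)))
        ≤ (s - t / 2) * (2 * u - u ^ 2 / 2) := mul_le_mul_of_nonneg_left h1 hs'.le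
    have h4 : (u - 4) + (s - t / 2) * (2 * u - u ^ 2 / 2)
        = (u - 4) * (1 - (s - t / 2) * u / 2) := by ring
    have h5 : 1 - (s - t / 2) * u / 2 ≤ 0 := by nlinarith
    nlinarith [mul_nonneg_of_nonpos_of_nonpos (by linarith : -(u - 4) ≤ 0) h5]

/-- A cubic polynomial with four zeros in arithmetic progression has zero leading coefficient. -/
lemma leading_coeff_eq_zero_of_progression {a b c d z h : ℝ} (hh : h ≠ 0)
    (H : ∀ j : ℕ, j ≤ 3 → a * (z + j * h) ^ 3 + b * (z + j * h) ^ 2 + c * (z + j * h) + d = 0) :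
    a = 0 := by
  have h0 := H 0 (by norm_num)
  have h1 := H 1 (by norm_num)
  have h2 := H 2 (by norm_num)
  have h3 := H 3 (by norm_num)
  push_cast at h0 h1 h2 h3
  -- The third finite difference of the polynomial is `6 a h³`.
  have : a * h ^ 3 = 0 := by linear_combination (h3 - 3 * h2 + 3 * h1 - h0) / 6
  exact (mul_eq_zero.1 this).resolve_right (pow_ne_zero 3 hh)

/-! ### Integrals depending on time -/

lemma integrable_of_abs_le {ν : Measure α} [IsFiniteMeasure ν] {f : α → ℝ} {C : ℝ}
    (hf : AEStronglyMeasurable f ν) (hC : ∀ x, |f x| ≤ C) : Integrable f ν :=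
  Integrable.of_bound hf C (ae_of_all _ hC)

lemma abs_integral_le {ν : Measure α} [IsProbabilityMeasure ν] {f : α → ℝ} {C : ℝ}
    (hC : ∀ x, |f x| ≤ C) : |∫ x, f x ∂ν| ≤ C := by
  have h : ∀ᵐ x ∂ν, ‖f x‖ ≤ C := ae_of_all _ hC
  simpa using norm_integral_le_of_norm_le_const h

lemma hasDerivAt_integral_of_abs_le {ν : Measure α} [IsFiniteMeasure ν] {F F' : α → ℝ → ℝ}
    {C a b t : ℝ} (ht : t ∈ Ioo a b)
    (hm : ∀ s ∈ Ioo a b, AEStronglyMeasurable (fun x => F x s) ν)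
    (hm' : AEStronglyMeasurable (fun x => F' x t) ν) (hi : Integrable (fun x => F x t) ν)
    (hd : ∀ x, ∀ s ∈ Ioo a b, HasDerivAt (F x) (F' x s) s)
    (hb : ∀ x, ∀ s ∈ Ioo a b, |F' x s| ≤ C) :
    HasDerivAt (fun s => ∫ x, F x s ∂ν) (∫ x, F' x t ∂ν) t := by
  have hn : Ioo a b ∈ 𝓝 t := Ioo_mem_nhds ht.1 ht.2
  exact (hasDerivAt_integral_of_dominated_loc_of_deriv_le (F := fun s x => F x s)
    (F' := fun s x => F' x s) (bound := fun _ => C) hn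
    (by filter_upwards [hn] with s hs using hm s hs) hi hm'
    (ae_of_all _ fun x s hs => hb x s hs) (integrable_const _)
    (ae_of_all _ fun x s hs => hd x s hs)).2

lemma eLpNorm_two_eq {ν : Measure α} {f : α → ℝ} (hf : MemLp f 2 ν) :
    eLpNorm f 2 ν = ENNReal.ofReal (√(∫ x, f x ^ 2 ∂ν)) := by
  rw [hf.eLpNorm_eq_integral_rpow_norm (by norm_num) (by norm_num), Real.sqrt_eq_rpow]
  simp

lemma memLp_two_of_abs_le {ν : Measure α} [IsFiniteMeasure ν] {f : α → ℝ} {C : ℝ}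
    (hf : AEStronglyMeasurable f ν) (hC : ∀ x, |f x| ≤ C) : MemLp f 2 ν :=
  MemLp.of_bound hf C (ae_of_all _ hC)

/-! ### Classical solutions -/

/-- Solutions that are differentiable in time for `t > 0`, at every point of the state space. -/
structure IsClassical (ν : Measure α) (μ : ℝ) (f : α → ℝ) (p : α → ℝ → ℝ) : Prop where
  aesm : ∀ t, 0 < t → AEStronglyMeasurable (fun x => p x t) ν
  deriv : ∀ x t, 0 < t →
    HasDerivAt (p x) ((∫ y, cubicStress (p y t) ∂ν) - cubicStress (p x t)) t
  mean : ∀ t, 0 < t → ∫ x, p x t ∂ν = μ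
  bound : ∀ x t, 0 < t → |p x t| ≤ |μ| + 4 + 4 / t
  initial : Tendsto (fun t => eLpNorm (fun x => p x t - f x) 2 ν) (𝓝[>] 0) (𝓝 0)

/-- Mean conservation and the universal bound are consequences of local boundedness. -/
lemma IsClassical.of_locally_bounded {ν : Measure α} [IsProbabilityMeasure ν] {μ : ℝ}
    {f : α → ℝ} {p : α → ℝ → ℝ} (hf : MemLp f 2 ν) (hfμ : ∫ x, f x ∂ν = μ)
    (aesm : ∀ t, 0 < t → AEStronglyMeasurable (fun x => p x t) ν)
    (deriv : ∀ x t, 0 < t →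
      HasDerivAt (p x) ((∫ y, cubicStress (p y t) ∂ν) - cubicStress (p x t)) t)
    (bdd : ∀ a b : ℝ, 0 < a → ∃ C, ∀ x, ∀ t ∈ Ioo a b, |p x t| ≤ C)
    (initial : Tendsto (fun t => eLpNorm (fun x => p x t - f x) 2 ν) (𝓝[>] 0) (𝓝 0)) :
    IsClassical ν μ f p := by
  have hint : ∀ t, 0 < t → Integrable (fun x => p x t) ν := by
    intro t ht
    obtain ⟨C, hC⟩ := bdd (t / 2) (2 * t) (by positivity)
    exact integrable_of_abs_le (aesm t ht) fun x => hC x t ⟨by linarith, by linarith⟩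
  have hder : ∀ t, 0 < t → HasDerivAt (fun s => ∫ x, p x s ∂ν) 0 t := by
    intro t ht
    obtain ⟨C, hC⟩ := bdd (t / 2) (2 * t) (by positivity)
    obtain ⟨B, -, hB⟩ := exists_cubicStress_bound C
    have htI : t ∈ Ioo (t / 2) (2 * t) := ⟨by linarith, by linarith⟩
    have hpos : ∀ s ∈ Ioo (t / 2) (2 * t), 0 < s := fun s hs => by linarith [hs.1]
    have hσ : AEStronglyMeasurable (fun x => cubicStress (p x t)) ν :=
      continuous_cubicStress.comp_aestronglyMeasurable (aesm t ht)
    have h := hasDerivAt_integral_of_abs_le (ν := ν) (C := B + B) (F := p)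
      (F' := fun x s => (∫ y, cubicStress (p y s) ∂ν) - cubicStress (p x s)) htI
      (fun s hs => aesm s (hpos s hs)) (aestronglyMeasurable_const.sub hσ) (hint t ht)
      (fun x s hs => deriv x s (hpos s hs)) (fun x s hs => (abs_sub _ _).trans
        (add_le_add (abs_integral_le fun y => hB _ (hC y s hs)) (hB _ (hC x s hs))))
    have h0 : ∫ x, ((∫ y, cubicStress (p y t) ∂ν) - cubicStress (p x t)) ∂ν = 0 := by
      rw [integral_sub (integrable_const _)
        (integrable_of_abs_le hσ fun x => hB _ (hC x t htI))]
      simp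
    simpa [h0] using h
  have hconst : ∀ s t, 0 < s → 0 < t → ∫ x, p x s ∂ν = ∫ x, p x t ∂ν := by
    intro s t hs ht
    exact isOpen_Ioi.is_const_of_deriv_eq_zero isPreconnected_Ioi
      (fun u hu => (hder u hu).differentiableAt.differentiableWithinAt)
      (fun u hu => (hder u hu).deriv) (show s ∈ Ioi (0 : ℝ) from hs) ht
  have hlim : Tendsto (fun t => ∫ x, p x t ∂ν) (𝓝[>] 0) (𝓝 μ) := by
    rw [← hfμ]
    refine tendsto_integral_of_L1' f hf.1 ?_ ?_
    · filter_upwards [self_mem_nhdsWithin] with t ht using hint t ht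
    · refine tendsto_of_tendsto_of_tendsto_of_le_of_le' tendsto_const_nhds initial
        (Eventually.of_forall fun _ => zero_le) ?_
      filter_upwards [self_mem_nhdsWithin] with t ht
      exact eLpNorm_le_eLpNorm_of_exponent_le (by norm_num) ((aesm t ht).sub hf.1)
  have hmean : ∀ t, 0 < t → ∫ x, p x t ∂ν = μ := by
    intro t ht
    refine tendsto_nhds_unique ?_ hlim
    refine (tendsto_const_nhds (x := ∫ x, p x t ∂ν)).congr' ?_
    filter_upwards [self_mem_nhdsWithin] with s hs using hconst t s ht hs
  refine ⟨aesm, deriv, hmean, fun x t ht => ?_, initial⟩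
  -- Since the mean is `μ`, the spread bound between trajectories becomes a bound on the deviation
  -- from `μ`.
  have hsub : p x t - μ = ∫ y, (p x t - p y t) ∂ν := by
    rw [integral_sub (integrable_const _) (hint t ht), hmean t ht]
    simp
  have h1 : |p x t - μ| ≤ 4 + 4 / t := by
    rw [hsub]
    refine abs_integral_le fun y => abs_sub_le_of_hasDerivAt (fun s hs => ?_) ht
    exact ((deriv x s hs).sub (deriv y s hs)).congr_deriv (by ring)
  have h2 := abs_sub_abs_le_abs_sub (p x t) μ
  linarith

/-! ### L² stability of classical solutions -/

section Classical

variable {ν : Measure α} {μ : ℝ} {f g : α → ℝ} {p q : α → ℝ → ℝ}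

lemma IsClassical.bound_of_le (hp : IsClassical ν μ f p) {τ : ℝ} (hτ : 0 < τ) (x : α) {t : ℝ}
    (ht : τ ≤ t) : |p x t| ≤ |μ| + 4 + 4 / τ := by
  refine (hp.bound x t (hτ.trans_le ht)).trans ?_
  gcongr

lemma IsClassical.aesm_stress (hp : IsClassical ν μ f p) {t : ℝ} (ht : 0 < t) :
    AEStronglyMeasurable (fun x => cubicStress (p x t)) ν :=
  continuous_cubicStress.comp_aestronglyMeasurable (hp.aesm t ht)

/-- Altering a classical solution on a null set of points. -/
lemma IsClassical.comp_ae_id (hp : IsClassical ν μ f p) {ρ : α → α} (hρ : ∀ᵐ x ∂ν, ρ x = x) :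
    IsClassical ν μ f (fun x => p (ρ x)) := by
  have hae : ∀ F : α → ℝ, (fun x => F (ρ x)) =ᵐ[ν] F := fun F => by
    filter_upwards [hρ] with x hx
    rw [hx]
  refine ⟨fun t ht => (hp.aesm t ht).congr (hae _).symm, fun x t ht => ?_, fun t ht => ?_,
    fun x t ht => hp.bound _ t ht, ?_⟩
  · rw [integral_congr_ae (hae fun y => cubicStress (p y t))]
    exact hp.deriv (ρ x) t ht
  · rw [integral_congr_ae (hae fun y => p y t), hp.mean t ht]
  · refine hp.initial.congr fun t => eLpNorm_congr_ae ?_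
    filter_upwards [hρ] with x hx
    rw [hx]

lemma IsClassical.continuousOn (hp : IsClassical ν μ f p) (x : α) : ContinuousOn (p x) (Ioi 0) :=
  fun t ht => (hp.deriv x t ht).continuousAt.continuousWithinAt

variable [IsProbabilityMeasure ν]

lemma IsClassical.memLp (hp : IsClassical ν μ f p) {t : ℝ} (ht : 0 < t) :
    MemLp (fun x => p x t) 2 ν :=
  memLp_two_of_abs_le (hp.aesm t ht) fun x => hp.bound x t ht

lemma IsClassical.integrable_stress (hp : IsClassical ν μ f p) {t : ℝ} (ht : 0 < t) :
    Integrable (fun x => cubicStress (p x t)) ν := by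
  obtain ⟨B, -, hB⟩ := exists_cubicStress_bound (|μ| + 4 + 4 / t)
  exact integrable_of_abs_le (hp.aesm_stress ht) fun x => hB _ (hp.bound x t ht)

/-- The equation is stable in `L²`, from positive times on. -/
lemma IsClassical.integral_sub_sq_le (hp : IsClassical ν μ f p) (hq : IsClassical ν μ g q)
    {s t : ℝ} (hs : 0 < s) (hst : s ≤ t) :
    ∫ x, (p x t - q x t) ^ 2 ∂ν ≤ Real.exp (2 * (t - s)) * ∫ x, (p x s - q x s) ^ 2 ∂ν := by
  let P : ℝ → ℝ := fun t => ∫ y, cubicStress (p y t) ∂ν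
  let Q : ℝ → ℝ := fun t => ∫ y, cubicStress (q y t) ∂ν
  let D : α → ℝ → ℝ := fun x t => 2 * (p x t - q x t) *
    ((P t - cubicStress (p x t)) - (Q t - cubicStress (q x t)))
  have hE : ∀ t, 0 < t → HasDerivAt (fun t => ∫ x, (p x t - q x t) ^ 2 ∂ν)
      (∫ x, D x t ∂ν) t := by
    intro t ht
    set C := |μ| + 4 + 4 / (t / 2)
    have hpC : ∀ x, ∀ s ∈ Ioo (t / 2) (2 * t), |p x s| ≤ C := fun x s hs =>
      hp.bound_of_le (by positivity) x hs.1.le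
    have hqC : ∀ x, ∀ s ∈ Ioo (t / 2) (2 * t), |q x s| ≤ C := fun x s hs =>
      hq.bound_of_le (by positivity) x hs.1.le
    obtain ⟨B, hB0, hB⟩ := exists_cubicStress_bound C
    have hC0 : 0 ≤ C := by positivity
    have hpos : ∀ s ∈ Ioo (t / 2) (2 * t), 0 < s := fun s hs => by linarith [hs.1]
    have htI : t ∈ Ioo (t / 2) (2 * t) := ⟨by linarith, by linarith⟩
    refine hasDerivAt_integral_of_abs_le (C := 2 * (C + C) * ((B + B) + (B + B))) htI
      (fun s hs => ((hp.aesm s (hpos s hs)).sub (hq.aesm s (hpos s hs))).pow 2) ?_ ?_ ?_ ?_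
    · exact (((hp.aesm t ht).sub (hq.aesm t ht)).const_mul 2).mul
        ((aestronglyMeasurable_const.sub (hp.aesm_stress ht)).sub
          (aestronglyMeasurable_const.sub (hq.aesm_stress ht)))
    · exact ((hp.memLp ht).sub (hq.memLp ht)).integrable_sq
    · intro x s hs
      have := ((hp.deriv x s (hpos s hs)).fun_sub (hq.deriv x s (hpos s hs))).fun_pow 2
      simpa [D, P, Q] using this
    · intro x s hs
      have e1 : |p x s - q x s| ≤ C + C := (abs_sub _ _).trans (add_le_add (hpC x s hs) (hqC x s hs))
      have e2 : |P s - cubicStress (p x s)| ≤ B + B := (abs_sub _ _).trans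
        (add_le_add (abs_integral_le fun y => hB _ (hpC y s hs)) (hB _ (hpC x s hs)))
      have e3 : |Q s - cubicStress (q x s)| ≤ B + B := (abs_sub _ _).trans
        (add_le_add (abs_integral_le fun y => hB _ (hqC y s hs)) (hB _ (hqC x s hs)))
      simp only [D]
      rw [abs_mul, abs_mul, abs_two]
      have e4 := (abs_sub (P s - cubicStress (p x s)) (Q s - cubicStress (q x s))).trans
        (add_le_add e2 e3)
      gcongr
  have hD : ∀ t, 0 < t → ∫ x, D x t ∂ν ≤ 2 * ∫ x, (p x t - q x t) ^ 2 ∂ν := by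
    intro t ht
    have hpm := hp.memLp ht
    have hqm := hq.memLp ht
    have hpi := hpm.integrable (by norm_num)
    have hqi := hqm.integrable (by norm_num)
    -- Equal means make the nonlocal part of the derivative integrate to zero.
    have h0 : ∫ x, 2 * (P t - Q t) * (p x t - q x t) ∂ν = 0 := by
      rw [integral_const_mul, integral_sub hpi hqi, hp.mean t ht, hq.mean t ht]; simp
    have i1 : Integrable (fun x => 2 * (p x t - q x t) ^ 2) ν :=
      (hpm.sub hqm).integrable_sq.const_mul 2
    have i2 : Integrable (fun x => 2 * (P t - Q t) * (p x t - q x t)) ν :=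
      (hpi.sub hqi).const_mul _
    rw [← integral_const_mul, ← add_zero (∫ x, 2 * (p x t - q x t) ^ 2 ∂ν), ← h0,
      ← integral_add i1 i2]
    refine integral_mono ?_ (i1.add i2) fun x => ?_
    · obtain ⟨B, hB0, hB⟩ := exists_cubicStress_bound (|μ| + 4 + 4 / t)
      refine (hpi.sub hqi).const_mul 2 |>.mul_bdd (c := (|P t| + B) + (|Q t| + B))
        ((aestronglyMeasurable_const.sub (hp.aesm_stress ht)).sub
          (aestronglyMeasurable_const.sub (hq.aesm_stress ht))) (ae_of_all _ fun x => ?_)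
      exact (abs_sub _ _).trans (add_le_add
        ((abs_sub _ _).trans (add_le_add le_rfl (hB _ (hp.bound x t ht))))
        ((abs_sub _ _).trans (add_le_add le_rfl (hB _ (hq.bound x t ht)))))
    · simp only [D]
      nlinarith [neg_sq_le_sub_mul_cubicStress_sub (p x t) (q x t)]
  have hanti : AntitoneOn (fun t => Real.exp (-(2 * t)) * ∫ x, (p x t - q x t) ^ 2 ∂ν)
      (Ioi 0) := by
    have hd : ∀ t, 0 < t → HasDerivAt
        (fun t => Real.exp (-(2 * t)) * ∫ x, (p x t - q x t) ^ 2 ∂ν)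
        (Real.exp (-(2 * t)) * (-2) * (∫ x, (p x t - q x t) ^ 2 ∂ν)
          + Real.exp (-(2 * t)) * ∫ x, D x t ∂ν) t := by
      intro t ht
      have h1 : HasDerivAt (fun t : ℝ => -(2 * t)) (-2) t := by
        simpa using ((hasDerivAt_id' t).const_mul 2).fun_neg
      exact h1.exp.mul (hE t ht)
    refine antitoneOn_of_deriv_nonpos (convex_Ioi _)
      (fun t ht => (hd t ht).continuousAt.continuousWithinAt) ?_ ?_
    · rw [interior_Ioi]
      exact fun t ht => (hd t ht).differentiableAt.differentiableWithinAt
    · rw [interior_Ioi]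
      intro t ht
      rw [(hd t ht).deriv]
      nlinarith [hD t ht, Real.exp_pos (-(2 * t))]
  have h := hanti (show s ∈ Ioi (0 : ℝ) from hs) (show t ∈ Ioi (0 : ℝ) from hs.trans_le hst) hst
  simp only at h
  calc ∫ x, (p x t - q x t) ^ 2 ∂ν
      = Real.exp (2 * t) * (Real.exp (-(2 * t)) * ∫ x, (p x t - q x t) ^ 2 ∂ν) := by
        rw [← mul_assoc, ← Real.exp_add]; simp
    _ ≤ Real.exp (2 * t) * (Real.exp (-(2 * s)) * ∫ x, (p x s - q x s) ^ 2 ∂ν) := by gcongr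
    _ = _ := by rw [← mul_assoc, ← Real.exp_add]; ring_nf

/-- The equation is stable in `L²` with respect to the initial data. -/
lemma IsClassical.eLpNorm_diff_le (hp : IsClassical ν μ f p) (hq : IsClassical ν μ g q)
    (hf : AEStronglyMeasurable f ν) (hg : AEStronglyMeasurable g ν) {t : ℝ} (ht : 0 < t) :
    eLpNorm (fun x => p x t - q x t) 2 ν
      ≤ ENNReal.ofReal (Real.exp t) * eLpNorm (fun x => f x - g x) 2 ν := by
  -- The estimate is available only from positive times `s`; the triangle inequality compares the
  -- states at `s` with `f` and `g`, and `s → 0⁺` removes the error.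
  have hlim : Tendsto (fun s => ENNReal.ofReal (Real.exp t) *
      (eLpNorm (fun x => p x s - f x) 2 ν + eLpNorm (fun x => f x - g x) 2 ν
        + eLpNorm (fun x => q x s - g x) 2 ν)) (𝓝[>] 0)
      (𝓝 (ENNReal.ofReal (Real.exp t) * eLpNorm (fun x => f x - g x) 2 ν)) := by
    have := (hp.initial.add_const (eLpNorm (fun x => f x - g x) 2 ν)).add hq.initial
    simp only [zero_add, add_zero] at this
    exact ENNReal.Tendsto.const_mul this (Or.inr ENNReal.ofReal_ne_top)
  refine ge_of_tendsto hlim ?_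
  filter_upwards [Ioo_mem_nhdsGT ht] with s hs
  have hs0 : 0 < s := hs.1
  have hms := (hp.memLp hs0).sub (hq.memLp hs0)
  have hmt := (hp.memLp ht).sub (hq.memLp ht)
  have h1 : eLpNorm (fun x => p x t - q x t) 2 ν
      ≤ ENNReal.ofReal (Real.exp t) * eLpNorm (fun x => p x s - q x s) 2 ν := by
    rw [eLpNorm_two_eq (f := fun x => p x t - q x t) hmt,
      eLpNorm_two_eq (f := fun x => p x s - q x s) hms,
      ← ENNReal.ofReal_mul (Real.exp_pos _).le]
    refine ENNReal.ofReal_le_ofReal ?_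
    rw [← Real.sqrt_sq (Real.exp_pos t).le, ← Real.sqrt_mul (sq_nonneg _)]
    refine Real.sqrt_le_sqrt ((hp.integral_sub_sq_le hq hs0 hs.2.le).trans ?_)
    refine mul_le_mul_of_nonneg_right ?_ (integral_nonneg fun x => sq_nonneg _)
    rw [sq, ← Real.exp_add]
    exact Real.exp_le_exp.2 (by linarith)
  refine h1.trans (mul_le_mul_right ?_ _)
  have h2 : (fun x => p x s - q x s)
      = (fun x => p x s - f x) + (fun x => f x - g x) - (fun x => q x s - g x) := by
    ext x; simp
  rw [h2]
  have m1 : AEStronglyMeasurable (fun x => p x s - f x) ν := (hp.aesm s hs0).sub hf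
  have m2 : AEStronglyMeasurable (fun x => f x - g x) ν := hf.sub hg
  have m3 : AEStronglyMeasurable (fun x => q x s - g x) ν := (hq.aesm s hs0).sub hg
  exact (eLpNorm_sub_le (m1.add m2) m3 (by norm_num)).trans
    (add_le_add_left (eLpNorm_add_le m1 m2 (by norm_num)) _)

end Classical

/-! ### Solutions are classical for positive times, up to a null set -/

instance : IsProbabilityMeasure unitMeasure := ⟨by simp [unitMeasure]⟩

/-- An integral equation with continuous integrand can be differentiated. -/
lemma hasDerivAt_of_integral_eq {u v : ℝ → ℝ} (hv : ContinuousOn v (Ioi 0))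
    (h : ∀ s t, 0 < s → 0 < t → u t = u s + ∫ r in s..t, v r) {t : ℝ} (ht : 0 < t) :
    HasDerivAt u (v t) t := by
  have h1 : HasDerivAt (fun r => ∫ s in t..r, v s) (v t) t :=
    intervalIntegral.integral_hasDerivAt_right (by simp)
      (hv.stronglyMeasurableAtFilter isOpen_Ioi t ht) (hv.continuousAt (Ioi_mem_nhds ht))
  refine (h1.const_add (u t)).congr_of_eventuallyEq ?_
  filter_upwards [Ioi_mem_nhds ht] with r hr using h t r ht hr

lemma continuousOn_integral_comp {ν : Measure α}
    [IsFiniteMeasure ν] {p : α → ℝ → ℝ}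
    (hm : ∀ t, 0 < t → AEStronglyMeasurable (fun x => p x t) ν)
    (hc : ∀ x, ContinuousOn (p x) (Ioi 0))
    (hb : ∀ a b : ℝ, 0 < a → ∃ C, ∀ x, ∀ t ∈ Ioo a b, |p x t| ≤ C) :
    ContinuousOn (fun t => ∫ x, cubicStress (p x t) ∂ν) (Ioi 0) := by
  intro t ht
  have ht' : 0 < t := ht
  obtain ⟨C, hC⟩ := hb (t / 2) (2 * t) (by positivity)
  obtain ⟨B, -, hB⟩ := exists_cubicStress_bound C
  have hn : Ioo (t / 2) (2 * t) ∈ 𝓝 t := Ioo_mem_nhds (by linarith) (by linarith)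
  refine ContinuousAt.continuousWithinAt
    (tendsto_integral_filter_of_dominated_convergence (fun _ => B) ?_ ?_ (integrable_const _) ?_)
  · filter_upwards [hn] with s hs
    exact continuous_cubicStress.comp_aestronglyMeasurable (hm s (by linarith [hs.1]))
  · filter_upwards [hn] with s hs
    exact ae_of_all _ fun x => hB _ (hC x s hs)
  · exact ae_of_all _ fun x => (continuous_cubicStress.continuousAt.comp
      ((hc x).continuousAt (Ioi_mem_nhds ht')))

lemma tendsto_eLpNorm_two_of_abs_le {ι : Type*} {ν : Measure α}
    [IsFiniteMeasure ν] {l : Filter ι} [l.IsCountablyGenerated] {F : ι → α → ℝ} {f : α → ℝ} {C : ℝ}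
    (hF : ∀ᶠ i in l, AEStronglyMeasurable (F i) ν) (hFC : ∀ᶠ i in l, ∀ x, |F i x| ≤ C)
    (hf : AEStronglyMeasurable f ν) (hfC : ∀ x, |f x| ≤ C)
    (h : ∀ᵐ x ∂ν, Tendsto (fun i => F i x) l (𝓝 (f x))) :
    Tendsto (fun i => eLpNorm (fun x => F i x - f x) 2 ν) l (𝓝 0) := by
  have h1 : Tendsto (fun i => ∫ x, (F i x - f x) ^ 2 ∂ν) l (𝓝 (∫ _, (0 : ℝ) ∂ν)) := by
    refine tendsto_integral_filter_of_dominated_convergence (fun _ => (C + C) ^ 2) ?_ ?_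
      (integrable_const _) ?_
    · filter_upwards [hF] with i hi using (hi.sub hf).pow 2
    · filter_upwards [hFC] with i hi
      refine ae_of_all _ fun x => ?_
      rw [norm_pow, Real.norm_eq_abs]
      exact pow_le_pow_left₀ (abs_nonneg _)
        ((abs_sub _ _).trans (add_le_add (hi x) (hfC x))) 2
    · filter_upwards [h] with x hx
      have : Tendsto (fun i => F i x - f x) l (𝓝 0) := by simpa using hx.sub_const (f x)
      simpa using this.pow 2
  have h2 := ENNReal.tendsto_ofReal ((Real.continuous_sqrt.tendsto _).comp h1)
  simp only [integral_zero, Real.sqrt_zero, ENNReal.ofReal_zero] at h2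
  refine h2.congr' ?_
  filter_upwards [hF, hFC] with i hi hiC
  exact (eLpNorm_two_eq (f := fun x => F i x - f x)
    ((memLp_two_of_abs_le hi hiC).sub (memLp_two_of_abs_le hf hfC))).symm

/-- The mean stress is not known to be continuous a priori, but it cancels in the difference of two
trajectories. That difference is therefore differentiable and obeys the universal spread bound, so
all trajectories are bounded locally in time relative to one of them. Dominated convergence then
makes the mean stress continuous, and the integrated equation can be differentiated. -/
lemma IsSolution.exists_isClassical {μ : ℝ} {p₀ : ℝ → ℝ} {p : ℝ → ℝ → ℝ}
    (hp₀ : p₀ ∈ dataSpace μ) (hp : IsSolution cubicStress p₀ p) :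
    ∃ q, IsClassical unitMeasure μ p₀ q ∧ ∀ᵐ x ∂unitMeasure, q x = p x := by
  classical
  obtain ⟨x₀, hx₀⟩ := (hp.netStress_integrable.and hp.equation).exists
  set A : Set ℝ := {x | (∀ τ T : ℝ, 0 < τ → τ < T →
      IntegrableOn (fun s => netStress cubicStress p x s) (Ioo τ T) volume) ∧
    ∀ s t : ℝ, 0 < s → 0 < t →
      p x t = p x s - ∫ τ in s..t, netStress cubicStress p x τ} with hA
  have hAae : ∀ᵐ x ∂unitMeasure, x ∈ A := hp.netStress_integrable.and hp.equation
  have hx₀A : x₀ ∈ A := hx₀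
  -- Exceptional points are given the trajectory of one good point, so that the equation holds at
  -- every point.
  set ρ : ℝ → ℝ := fun x => if x ∈ A then x else x₀ with hρ
  have hρA : ∀ x, ρ x ∈ A := fun x => by
    by_cases hx : x ∈ A
    · simp [hρ, hx]
    · simpa [hρ, hx] using hx₀A
  have hρae : ∀ᵐ x ∂unitMeasure, ρ x = x := by
    filter_upwards [hAae] with x hx
    simp [hρ, hx]
  have hii : ∀ x ∈ A, ∀ s t : ℝ, 0 < s → 0 < t →
      IntervalIntegrable (fun r => netStress cubicStress p x r) volume s t := by
    intro x hx s t hs ht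
    rw [intervalIntegrable_iff]
    have h := hx.1 (min s t / 2) (max s t + 1) (by positivity)
      (by linarith [min_le_max (a := s) (b := t), lt_min hs ht])
    refine h.mono_set fun r hr => ?_
    rw [uIoc, mem_Ioc] at hr
    exact ⟨by linarith [lt_min hs ht], by linarith⟩
  have hcont : ∀ x ∈ A, ContinuousOn (p x) (Ioi 0) := by
    intro x hx t ht
    have ht' : 0 < t := ht
    have hle : t / 2 ≤ 2 * t := by linarith
    have h1 : IntegrableOn (fun r => netStress cubicStress p x r) (uIcc (t / 2) (2 * t)) := by
      rw [uIcc_of_le hle, integrableOn_Icc_iff_integrableOn_Ioo]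
      exact hx.1 _ _ (by positivity) (by linarith)
    have h2 := intervalIntegral.continuousOn_primitive_interval h1
    rw [uIcc_of_le hle] at h2
    have hn : Icc (t / 2) (2 * t) ∈ 𝓝 t := Icc_mem_nhds (by linarith) (by linarith)
    have h3 := (h2.continuousAt hn).const_sub (p x (t / 2))
    refine ContinuousAt.continuousWithinAt (ContinuousAt.congr h3 ?_)
    filter_upwards [Ioi_mem_nhds ht'] with r hr
    exact (hx.2 (t / 2) r (by positivity) hr).symm
  have hspread : ∀ x ∈ A, ∀ y ∈ A, ∀ t, 0 < t → |p x t - p y t| ≤ 4 + 4 / t := by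
    intro x hx y hy t ht
    refine abs_sub_le_of_hasDerivAt (fun s hs => ?_) ht
    refine hasDerivAt_of_integral_eq (u := fun s => p x s - p y s)
      (v := fun s => cubicStress (p y s) - cubicStress (p x s)) ?_ ?_ hs
    · exact (continuous_cubicStress.comp_continuousOn (hcont y hy)).sub
        (continuous_cubicStress.comp_continuousOn (hcont x hx))
    · intro a b ha hb
      have h : ∀ r, cubicStress (p y r) - cubicStress (p x r)
          = netStress cubicStress p y r - netStress cubicStress p x r := fun r => by
        simp [netStress]
      simp only [h]
      rw [intervalIntegral.integral_sub (hii y hy a b ha hb) (hii x hx a b ha hb),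
        hx.2 a b ha hb, hy.2 a b ha hb]
      ring
  have haesm : ∀ t, 0 < t → AEStronglyMeasurable (fun x => p (ρ x) t) unitMeasure := by
    intro t ht
    refine (hp.memLp t ht.le).1.congr ?_
    filter_upwards [hρae] with x hx
    rw [hx]
  have hbdd : ∀ a b : ℝ, 0 < a → ∃ C, ∀ x, ∀ t ∈ Ioo a b, |p (ρ x) t| ≤ C := by
    intro a b ha
    obtain ⟨C, hC⟩ := (isCompact_Icc (a := a) (b := b)).exists_bound_of_continuousOn
      ((hcont x₀ hx₀A).mono fun t ht => ha.trans_le ht.1)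
    refine ⟨C + (4 + 4 / a), fun x t ht => ?_⟩
    have h1 : |p x₀ t| ≤ C := hC t ⟨ht.1.le, ht.2.le⟩
    have h2 := hspread (ρ x) (hρA x) x₀ hx₀A t (ha.trans ht.1)
    have h3 : 4 / t ≤ 4 / a := by
      have := ht.1.le
      gcongr
    have h4 := abs_sub_abs_le_abs_sub (p (ρ x) t) (p x₀ t)
    linarith
  have hN : ∀ t, ∫ y, cubicStress (p (ρ y) t) ∂unitMeasure
      = ∫ y, cubicStress (p y t) ∂unitMeasure := by
    intro t
    refine integral_congr_ae ?_
    filter_upwards [hρae] with x hx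
    rw [hx]
  have hNc := continuousOn_integral_comp haesm (fun x => hcont _ (hρA x)) hbdd
  refine ⟨fun x => p (ρ x), IsClassical.of_locally_bounded hp₀.1 hp₀.2 haesm ?_ hbdd ?_, ?_⟩
  · intro x t ht
    refine hasDerivAt_of_integral_eq
      (v := fun t => (∫ y, cubicStress (p (ρ y) t) ∂unitMeasure) - cubicStress (p (ρ x) t))
      (hNc.sub (continuous_cubicStress.comp_continuousOn (hcont _ (hρA x)))) ?_ ht
    intro a b ha hb
    rw [(hρA x).2 a b ha hb, sub_eq_add_neg, ← intervalIntegral.integral_neg]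
    congr 2
    ext r
    rw [hN, netStress]
    ring
  · have h := (hp.continuous_L2 0 le_rfl).mono_left (nhdsWithin_mono _ Ioi_subset_Ici_self)
    refine h.congr fun t => eLpNorm_congr_ae ?_
    filter_upwards [hρae, hp.initial] with x hx hx0
    rw [hx, hx0]
  · filter_upwards [hρae] with x hx
    rw [hx]

/-- Classical solutions with the same initial data agree. -/
lemma IsClassical.ae_eq {ν : Measure α} [IsProbabilityMeasure ν]
    {μ : ℝ} {f : α → ℝ} {p q : α → ℝ → ℝ} (hf : AEStronglyMeasurable f ν)
    (hp : IsClassical ν μ f p) (hq : IsClassical ν μ f q) :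
    ∀ᵐ x ∂ν, ∀ t, 0 < t → p x t = q x t := by
  have h1 : ∀ t, 0 < t → ∀ᵐ x ∂ν, p x t = q x t := by
    intro t ht
    have h := hp.eLpNorm_diff_le hq hf hf ht
    simp only [sub_self, eLpNorm_zero', mul_zero, nonpos_iff_eq_zero] at h
    have h0 := (eLpNorm_eq_zero_iff ((hp.aesm t ht).sub (hq.aesm t ht)) (by norm_num)).1 h
    filter_upwards [h0] with x hx
    simpa [sub_eq_zero] using hx
  -- Rational times give one null set for all times; continuity in time does the rest.
  have h2 : ∀ᵐ x ∂ν, ∀ r : ℚ, 0 < (r : ℝ) → p x r = q x r := by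
    rw [ae_all_iff]
    intro r
    by_cases hr : 0 < (r : ℝ)
    · filter_upwards [h1 r hr] with x hx _ using hx
    · exact ae_of_all _ fun x h => absurd h hr
  filter_upwards [h2] with x hx t ht
  by_contra hne
  have hc : ContinuousAt (fun t => p x t - q x t) t :=
    (hp.deriv x t ht).continuousAt.sub (hq.deriv x t ht).continuousAt
  have hev : ∀ᶠ s in 𝓝 t, p x s - q x s ≠ 0 ∧ 0 < s :=
    (hc.eventually_ne (sub_ne_zero.2 hne)).and (Ioi_mem_nhds ht)
  obtain ⟨r, hr⟩ := Rat.denseRange_cast.exists_mem_open isOpen_interior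
    ⟨t, mem_interior_iff_mem_nhds.2 hev⟩
  have := interior_subset hr
  exact this.1 (sub_eq_zero.2 (hx r this.2))

/-- A classical solution gives a solution, after resetting the values at time zero. -/
lemma IsClassical.isSolution {μ : ℝ} {p₀ : ℝ → ℝ} {p : ℝ → ℝ → ℝ} (hp₀ : MemLp p₀ 2 unitMeasure)
    (hp : IsClassical unitMeasure μ p₀ p) :
    IsSolution cubicStress p₀ (fun x t => if t = 0 then p₀ x else p x t) := by
  have hNc := continuousOn_integral_comp hp.aesm hp.continuousOn fun a b ha =>
    ⟨_, fun x t ht => hp.bound_of_le ha x ht.1.le⟩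
  have hvc : ∀ x, ContinuousOn
      (fun t => cubicStress (p x t) - ∫ y, cubicStress (p y t) ∂unitMeasure) (Ioi 0) := fun x =>
    (continuous_cubicStress.comp_continuousOn (hp.continuousOn x)).sub hNc
  have hnet : ∀ x t, 0 < t →
      netStress cubicStress (fun x t => if t = 0 then p₀ x else p x t) x t
        = cubicStress (p x t) - ∫ y, cubicStress (p y t) ∂unitMeasure := by
    intro x t ht
    simp [netStress, ht.ne']
  refine ⟨fun t ht => ?_, fun t ht => ?_, ?_, ?_, ?_, ?_⟩
  · rcases ht.eq_or_lt with rfl | ht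
    · simpa using hp₀
    · simpa [ht.ne'] using hp.memLp ht
  · rcases ht.eq_or_lt with rfl | ht
    · rw [← Ioi_insert, nhdsWithin_insert, tendsto_sup]
      constructor
      · rw [tendsto_pure_left]
        intro s hs
        simpa using mem_of_mem_nhds hs
      · refine hp.initial.congr' ?_
        filter_upwards [self_mem_nhdsWithin] with s hs
        simp [(show (0 : ℝ) < s from hs).ne']
    · have hn : Ioi (t / 2) ∈ 𝓝 t := Ioi_mem_nhds (by linarith)
      have ht2 : 0 < t / 2 := by positivity
      have h := tendsto_eLpNorm_two_of_abs_le (l := 𝓝 t) (F := fun s x => p x s)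
        (f := fun x => p x t) (C := |μ| + 4 + 4 / (t / 2))
        (by filter_upwards [hn] with s hs using hp.aesm s (ht2.trans hs))
        (by filter_upwards [hn] with s hs using fun x => hp.bound_of_le ht2 x hs.le)
        (hp.aesm t ht) (fun x => hp.bound_of_le ht2 x (by linarith))
        (ae_of_all _ fun x => (hp.deriv x t ht).continuousAt)
      refine (h.congr' ?_).mono_left nhdsWithin_le_nhds
      filter_upwards [hn] with s hs
      simp [ht.ne', (ht2.trans hs).ne']
  · exact ae_of_all _ fun x => by simp
  · rw [Measure.restrict_congr_set Ioi_ae_eq_Ici.symm]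
    refine (ae_restrict_iff' measurableSet_Ioi).2 (ae_of_all _ fun t ht => ?_)
    simpa [(show (0 : ℝ) < t from ht).ne'] using hp.integrable_stress ht
  · refine ae_of_all _ fun x τ T hτ hT => ?_
    have h1 : IntegrableOn (fun t => cubicStress (p x t) - ∫ y, cubicStress (p y t) ∂unitMeasure)
        (Icc τ T) := ((hvc x).mono fun t ht => hτ.trans_le ht.1).integrableOn_Icc
    refine (h1.mono_set Ioo_subset_Icc_self).congr_fun (fun t ht => ?_) measurableSet_Ioo
    exact (hnet x t (hτ.trans ht.1)).symm
  · refine ae_of_all _ fun x s t hs ht => ?_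
    have hsub : ∀ r ∈ uIcc s t, 0 < r := fun r hr => (lt_min hs ht).trans_le hr.1
    have h1 : ∫ r in s..t, netStress cubicStress (fun x t => if t = 0 then p₀ x else p x t) x r
        = ∫ r in s..t, -((∫ y, cubicStress (p y r) ∂unitMeasure) - cubicStress (p x r)) :=
      intervalIntegral.integral_congr fun r hr => by rw [hnet x r (hsub r hr)]; ring
    have h2 := intervalIntegral.integral_eq_sub_of_hasDerivAt
      (fun r hr => hp.deriv x r (hsub r hr))
      (((hvc x).neg.mono fun r hr => hsub r hr).congr
        fun r _ => (by simp : _ = _)).intervalIntegrable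
    simp only [hs.ne', ht.ne', if_false]
    rw [h1, intervalIntegral.integral_neg, h2]
    ring

/-! ### Bounded continuous initial data -/

/-- A bounded Lipschitz vector field on a Banach space has global integral curves. -/
lemma exists_hasDerivAt_of_lipschitzWith {E : Type*} [NormedAddCommGroup E] [NormedSpace ℝ E]
    [CompleteSpace E] {F : E → E} {K L : ℝ≥0} (hF : LipschitzWith K F) (hL : ∀ x, ‖F x‖ ≤ L)
    (x₀ : E) : ∃ X : ℝ → E, X 0 = x₀ ∧ ∀ t, HasDerivAt X (F (X t)) t := by
  -- Speed at most `L` keeps the curve in the ball of radius `L(n + 1)`, so Picard–Lindelöf applies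
  -- on the whole interval.
  have hex : ∀ n : ℕ, ∃ X : ℝ → E, X 0 = x₀ ∧ ∀ t ∈ Icc (-(n : ℝ) - 1) (n + 1),
      HasDerivWithinAt X (F (X t)) (Icc (-(n : ℝ) - 1) (n + 1)) t := by
    intro n
    have h0 : (0 : ℝ) ∈ Icc (-(n : ℝ) - 1) (n + 1) := ⟨by linarith [n.cast_nonneg (α := ℝ)],
      by positivity⟩
    have hPL : IsPicardLindelof (fun _ => F) (⟨0, h0⟩ : Icc (-(n : ℝ) - 1) (n + 1)) x₀
        (L * (n + 1)) 0 L K := by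
      refine ⟨fun t _ => hF.lipschitzOnWith, fun x _ => continuousOn_const,
        fun t _ x _ => hL x, ?_⟩
      push_cast
      have : max ((n : ℝ) + 1 - 0) (0 - (-(n : ℝ) - 1)) = n + 1 := by
        rw [max_eq_left] <;> linarith
      exact (congrArg _ this).le.trans (sub_zero _).ge
    exact hPL.exists_eq_forall_mem_Icc_hasDerivWithinAt (by simp)
  choose X hX0 hX using hex
  have hXd : ∀ n : ℕ, ∀ t ∈ Ioo (-(n : ℝ) - 1) (n + 1), HasDerivAt (X n) (F (X n t)) t :=
    fun n t ht => (hX n t (Ioo_subset_Icc_self ht)).hasDerivAt (Icc_mem_nhds ht.1 ht.2)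
  have hXc : ∀ n : ℕ, ContinuousOn (X n) (Icc (-(n : ℝ) - 1) (n + 1)) :=
    fun n t ht => (hX n t ht).continuousWithinAt
  have heq : ∀ m n : ℕ, m ≤ n → EqOn (X m) (X n) (Icc (-(m : ℝ) - 1) (m + 1)) := by
    intro m n hmn
    have hmn' : (m : ℝ) ≤ n := by exact_mod_cast hmn
    refine ODE_solution_unique_of_mem_Icc (v := fun _ => F) (s := fun _ => univ) (t₀ := 0)
      (fun t _ => hF.lipschitzOnWith) ⟨by linarith [m.cast_nonneg (α := ℝ)], by positivity⟩
      (hXc m) (hXd m) (fun _ _ => mem_univ _)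
      ((hXc n).mono (Icc_subset_Icc (by linarith) (by linarith)))
      (fun t ht => hXd n t ⟨by linarith [ht.1], by linarith [ht.2]⟩) (fun _ _ => mem_univ _)
      ((hX0 m).trans (hX0 n).symm)
  -- The extra unit in the half-length `n + 1` places `t` in the interior of the interval indexed by
  -- `⌈|t|⌉₊`.
  refine ⟨fun t => X ⌈|t|⌉₊ t, hX0 _, fun t => ?_⟩
  set n := ⌈|t|⌉₊ with hn
  have ht : |t| ≤ n := Nat.le_ceil _
  have htI : t ∈ Ioo (-(n : ℝ) - 1) (n + 1) := by
    rw [abs_le] at ht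
    exact ⟨by linarith [ht.1], by linarith [ht.2]⟩
  refine (hXd n t htI).congr_of_eventuallyEq ?_
  filter_upwards [Ioo_mem_nhds htI.1 htI.2] with s hs
  have hs' : s ∈ Icc (-(⌈|s|⌉₊ : ℝ) - 1) (⌈|s|⌉₊ + 1) := by
    have h := Nat.le_ceil |s|
    rw [abs_le] at h
    exact ⟨by linarith [h.1], by linarith [h.2]⟩
  rcases le_total n ⌈|s|⌉₊ with h | h
  · exact (heq _ _ h (Ioo_subset_Icc_self hs)).symm
  · exact heq _ _ h hs'

/-- The stress, made constant outside `[-R, R]`. -/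
def truncatedStress (R x : ℝ) : ℝ := cubicStress (max (-R) (min R x))

lemma abs_clamp_le {R : ℝ} (hR : 0 ≤ R) (x : ℝ) : |max (-R) (min R x)| ≤ R :=
  abs_le.2 ⟨le_max_left _ _, max_le (by linarith) (min_le_left _ _)⟩

lemma exists_lipschitzWith_truncatedStress {R : ℝ} (hR : 0 ≤ R) :
    ∃ K : ℝ≥0, LipschitzWith K (truncatedStress R) := by
  obtain ⟨L, hL0, hL⟩ := exists_cubicStress_lipschitz R
  refine ⟨NNReal.mk L hL0, LipschitzWith.of_dist_le_mul fun x y => ?_⟩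
  have h1 : LipschitzWith 1 fun x : ℝ => max (-R) (min R x) :=
    (LipschitzWith.id.const_min R).const_max (-R)
  have h2 := h1.dist_le_mul x y
  rw [NNReal.coe_one, one_mul] at h2
  exact (hL _ _ (abs_clamp_le hR x) (abs_clamp_le hR y)).trans
    (mul_le_mul_of_nonneg_left h2 hL0)

lemma abs_truncatedStress_le {R : ℝ} (hR : 2 ≤ R) (x : ℝ) :
    |truncatedStress R x| ≤ cubicStress R := by
  have h := abs_le.1 (abs_clamp_le (by linarith : 0 ≤ R) x)
  refine abs_le.2 ⟨?_, cubicStress_le_of_le hR h.2⟩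
  have := cubicStress_le_of_le hR (x := -max (-R) (min R x)) (by linarith [h.1])
  rw [cubicStress_neg] at this
  unfold truncatedStress
  linarith

/-- With the truncated stress the equation is an ODE with a bounded Lipschitz field on bounded
continuous functions. Beyond `R` the truncated stress equals `σ(R)`, which its mean never exceeds,
and symmetrically below `-R`; so `[-R, R]` is invariant forward in time and the truncation is never
felt. -/
lemma exists_isClassical_of_bounded (ν : Measure ℝ) [IsProbabilityMeasure ν] (f : ℝ →ᵇ ℝ) :
    ∃ p : ℝ → ℝ → ℝ, IsClassical ν (∫ x, f x ∂ν) f p ∧ ∀ t, Continuous fun x => p x t := by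
  set R : ℝ := max 2 ‖f‖ with hRdef
  have hR : 2 ≤ R := le_max_left _ _
  have hR0 : 0 ≤ R := by linarith
  have hσR : 0 ≤ cubicStress R := (abs_nonneg _).trans (abs_truncatedStress_le hR 0)
  obtain ⟨K, hK⟩ := exists_lipschitzWith_truncatedStress hR0
  let F : (ℝ →ᵇ ℝ) → (ℝ →ᵇ ℝ) := fun h =>
    BoundedContinuousFunction.const ℝ (∫ y, truncatedStress R (h y) ∂ν) - h.comp _ hK
  have hFapp : ∀ h x, F h x = (∫ y, truncatedStress R (h y) ∂ν) - truncatedStress R (h x) :=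
    fun h x => rfl
  have hint : ∀ h : ℝ →ᵇ ℝ, Integrable (fun y => truncatedStress R (h y)) ν := fun h =>
    integrable_of_abs_le (hK.continuous.comp h.continuous).aestronglyMeasurable
      fun x => abs_truncatedStress_le hR _
  have hFL : LipschitzWith (2 * K) F := by
    refine LipschitzWith.of_dist_le_mul fun h k => ?_
    rw [BoundedContinuousFunction.dist_le (by positivity)]
    intro x
    have hp : ∀ y, |truncatedStress R (h y) - truncatedStress R (k y)| ≤ K * dist h k := fun y =>
      (hK.dist_le_mul _ _).trans
        (mul_le_mul_of_nonneg_left (BoundedContinuousFunction.dist_coe_le_dist y) K.2)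
    rw [Real.dist_eq, hFapp, hFapp, sub_sub_sub_comm, ← integral_sub (hint h) (hint k)]
    refine (abs_sub _ _).trans ((add_le_add (abs_integral_le hp) (hp x)).trans_eq ?_)
    push_cast
    ring
  have hFB : ∀ h, ‖F h‖ ≤ NNReal.mk (2 * cubicStress R) (by positivity) := by
    intro h
    refine (BoundedContinuousFunction.norm_le (NNReal.coe_nonneg _)).2 fun x => ?_
    rw [hFapp, NNReal.coe_mk, two_mul]
    exact (abs_sub _ _).trans (add_le_add (abs_integral_le fun y => abs_truncatedStress_le hR _)
      (abs_truncatedStress_le hR _))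
  obtain ⟨X, hX0, hX⟩ := exists_hasDerivAt_of_lipschitzWith hFL hFB f
  have hXd : ∀ x t, HasDerivAt (fun s => X s x)
      ((∫ y, truncatedStress R (X t y) ∂ν) - truncatedStress R (X t x)) t := fun x t =>
    (BoundedContinuousFunction.evalCLM ℝ x :
      (ℝ →ᵇ ℝ) →L[ℝ] ℝ).hasFDerivAt.comp_hasDerivAt t (hX t)
  have hf : ∀ x, |f x| ≤ R := fun x => (f.norm_coe_le_norm x).trans (le_max_right _ _)
  have hXc : ∀ x, Continuous fun s => X s x := fun x =>
    continuous_iff_continuousAt.2 fun t => (hXd x t).continuousAt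
  have hXR : ∀ x t, 0 ≤ t → |X t x| ≤ R := by
    intro x t ht
    have hI := fun s => abs_le.1
      (abs_integral_le (ν := ν) fun y => abs_truncatedStress_le hR (X s y))
    rw [abs_le]
    constructor
    · have := nonpos_of_deriv_nonpos_of_pos (f := fun s => -R - X s x) ht
        (continuous_const.sub (hXc x)).continuousOn
        (fun s _ => (hXd x s).const_sub (-R)) (fun s _ hs => ?_) ?_
      · linarith
      · have h1 : truncatedStress R (X s x) = -cubicStress R := by
          unfold truncatedStress
          rw [min_eq_right (by linarith), max_eq_left (by linarith), cubicStress_neg]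
        rw [h1]
        linarith [(hI s).1]
      · rw [hX0]
        linarith [(abs_le.1 (hf x)).1]
    · have := nonpos_of_deriv_nonpos_of_pos (f := fun s => X s x - R) ht
        ((hXc x).sub continuous_const).continuousOn
        (fun s _ => (hXd x s).sub_const R) (fun s _ hs => ?_) ?_
      · linarith
      · have h1 : truncatedStress R (X s x) = cubicStress R := by
          unfold truncatedStress
          rw [min_eq_left (by linarith), max_eq_right (by linarith)]
        rw [h1]
        linarith [(hI s).2]
      · rw [hX0]
        linarith [(abs_le.1 (hf x)).2]
  have htr : ∀ x t, 0 ≤ t → truncatedStress R (X t x) = cubicStress (X t x) := by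
    intro x t ht
    have h := abs_le.1 (hXR x t ht)
    unfold truncatedStress
    rw [min_eq_right h.2, max_eq_right h.1]
  have hm : ∀ t, AEStronglyMeasurable (fun x => X t x) ν := fun t =>
    (X t).continuous.aestronglyMeasurable
  refine ⟨fun x t => X t x, IsClassical.of_locally_bounded
    (memLp_two_of_abs_le f.continuous.aestronglyMeasurable hf) rfl (fun t _ => hm t) ?_ ?_ ?_,
    fun t => (X t).continuous⟩
  · intro x t ht
    have h := hXd x t
    rw [htr x t ht.le, integral_congr_ae (ae_of_all _ fun y => htr y t ht.le)] at h
    exact h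
  · exact fun a b ha => ⟨R, fun x t ht => hXR x t (ha.trans ht.1).le⟩
  · refine tendsto_eLpNorm_two_of_abs_le (F := fun t x => X t x) (C := R)
      (Eventually.of_forall hm) ?_ f.continuous.aestronglyMeasurable hf (ae_of_all _ fun x => ?_)
    · filter_upwards [self_mem_nhdsWithin] with t ht using fun x =>
        hXR x t (show (0 : ℝ) < t from ht).le
    · have := ((hXc x).tendsto 0).mono_left (nhdsWithin_le_nhds (s := Ioi 0))
      rwa [hX0] at this

/-! ### General initial data -/

/-- Stability needs equal means, so a density approximant is shifted by a constant; the shift is at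
most its L¹ error, hence its L² error, which costs the second half of `ε`. -/
lemma exists_boundedContinuous_approx {ν : Measure ℝ} [IsProbabilityMeasure ν] {f : ℝ → ℝ}
    (hf : MemLp f 2 ν) {ε : ENNReal} (hε : ε ≠ 0) :
    ∃ g : ℝ →ᵇ ℝ, ∫ x, g x ∂ν = ∫ x, f x ∂ν ∧ eLpNorm (fun x => f x - g x) 2 ν ≤ ε := by
  obtain ⟨g, hg, hgm⟩ := hf.exists_boundedContinuous_eLpNorm_sub_le (by norm_num)
    (ENNReal.half_pos hε).ne'
  have hfi := hf.integrable (by norm_num)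
  have hgi := hgm.integrable (by norm_num)
  set c : ℝ := ∫ x, f x ∂ν - ∫ x, g x ∂ν with hc
  refine ⟨g + BoundedContinuousFunction.const ℝ c, ?_, ?_⟩
  · simp only [BoundedContinuousFunction.coe_add, Pi.add_apply,
      BoundedContinuousFunction.const_apply]
    rw [integral_add hgi (integrable_const _)]
    simp [hc]
  · have h1 : (fun x => f x - (g + BoundedContinuousFunction.const ℝ c) x)
        = (f - ⇑g) - fun _ => c := by
      ext x
      simp [sub_sub]
    have h2 : eLpNorm (fun _ : ℝ => c) 2 ν ≤ ε / 2 := by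
      rw [eLpNorm_const _ (by norm_num) (IsProbabilityMeasure.ne_zero ν), measure_univ,
        ENNReal.one_rpow, mul_one]
      calc ‖c‖ₑ = ‖∫ x, (f - ⇑g) x ∂ν‖ₑ := by
            simp only [Pi.sub_apply]
            rw [integral_sub hfi hgi]
        _ ≤ ∫⁻ x, ‖(f - ⇑g) x‖ₑ ∂ν := enorm_integral_le_lintegral_enorm _
        _ = eLpNorm (f - ⇑g) 1 ν := eLpNorm_one_eq_lintegral_enorm.symm
        _ ≤ eLpNorm (f - ⇑g) 2 ν :=
            eLpNorm_le_eLpNorm_of_exponent_le (by norm_num) (hf.1.sub hgm.1)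
        _ ≤ ε / 2 := hg
    rw [h1]
    exact (eLpNorm_sub_le (hf.1.sub hgm.1) aestronglyMeasurable_const (by norm_num)).trans
      ((add_le_add hg h2).trans_eq (ENNReal.add_halves _))

lemma integral_abs_le_of_eLpNorm_two_le {ν : Measure α}
    [IsProbabilityMeasure ν] {h : α → ℝ} (hh : MemLp h 2 ν) {c : ℝ} (hc : 0 ≤ c)
    (hle : eLpNorm h 2 ν ≤ ENNReal.ofReal c) : ∫ x, |h x| ∂ν ≤ c := by
  have h1 := (eLpNorm_le_eLpNorm_of_exponent_le (by norm_num : (1 : ENNReal) ≤ 2) hh.1).trans hle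
  rw [eLpNorm_one_eq_lintegral_enorm,
    ← ofReal_integral_norm_eq_lintegral_enorm (hh.integrable (by norm_num))] at h1
  simpa using (ENNReal.ofReal_le_ofReal_iff hc).1 h1

/-- Dependence of a trajectory on its starting value and on its forcing. -/
lemma sq_sub_le_of_forcing {a b M N : ℝ → ℝ} {s t δ : ℝ} (hs : 0 < s) (hst : s ≤ t)
    (ha : ∀ r, 0 < r → HasDerivAt a (M r - cubicStress (a r)) r)
    (hb : ∀ r, 0 < r → HasDerivAt b (N r - cubicStress (b r)) r)
    (hδ : ∀ r ∈ Icc s t, |M r - N r| ≤ δ) :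
    (a t - b t) ^ 2 ≤ Real.exp (3 * (t - s)) * ((a s - b s) ^ 2 + δ ^ 2) := by
  have hd : ∀ r, 0 < r → HasDerivAt
      (fun r => Real.exp (-(3 * r)) * ((a r - b r) ^ 2 + δ ^ 2))
      (Real.exp (-(3 * r)) * (-3) * ((a r - b r) ^ 2 + δ ^ 2) + Real.exp (-(3 * r)) *
        (2 * (a r - b r) * ((M r - cubicStress (a r)) - (N r - cubicStress (b r))))) r := by
    intro r hr
    have h1 : HasDerivAt (fun r : ℝ => -(3 * r)) (-3) r := by
      simpa using ((hasDerivAt_id' r).const_mul 3).fun_neg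
    have h2 := (((ha r hr).fun_sub (hb r hr)).fun_pow 2).add_const (δ ^ 2)
    refine (h1.exp.fun_mul h2).congr_deriv ?_
    simp
  have hanti : AntitoneOn (fun r => Real.exp (-(3 * r)) * ((a r - b r) ^ 2 + δ ^ 2))
      (Icc s t) := by
    refine antitoneOn_of_deriv_nonpos (convex_Icc _ _)
      (fun r hr => (hd r (hs.trans_le hr.1)).continuousAt.continuousWithinAt) ?_ ?_
    · rw [interior_Icc]
      exact fun r hr => (hd r (hs.trans hr.1)).differentiableAt.differentiableWithinAt
    · rw [interior_Icc]
      intro r hr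
      rw [(hd r (hs.trans hr.1)).deriv]
      have h1 := neg_sq_le_sub_mul_cubicStress_sub (a r) (b r)
      have h2 : (M r - N r) ^ 2 ≤ δ ^ 2 := by
        have := hδ r (Ioo_subset_Icc_self hr)
        exact sq_le_sq' (abs_le.1 this).1 (abs_le.1 this).2
      -- The rate 3 is 2 from the one-sided bound on `σ` plus 1 from `2w(M - N) ≤ w² + (M - N)²`,
      -- where `w = a - b`.
      have h3 : -3 * ((a r - b r) ^ 2 + δ ^ 2)
          + 2 * (a r - b r) * ((M r - cubicStress (a r)) - (N r - cubicStress (b r))) ≤ 0 := by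
        nlinarith [sq_nonneg ((a r - b r) - (M r - N r)), sq_nonneg δ]
      have := mul_nonpos_of_nonneg_of_nonpos (Real.exp_pos (-(3 * r))).le h3
      linarith
  have h := hanti (left_mem_Icc.2 hst) (right_mem_Icc.2 hst) hst
  simp only at h
  calc (a t - b t) ^ 2
      ≤ Real.exp (3 * t) * (Real.exp (-(3 * t)) * ((a t - b t) ^ 2 + δ ^ 2)) := by
        rw [← mul_assoc, ← Real.exp_add]
        simp [sq_nonneg]
    _ ≤ Real.exp (3 * t) * (Real.exp (-(3 * s)) * ((a s - b s) ^ 2 + δ ^ 2)) := by gcongr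
    _ = _ := by rw [← mul_assoc, ← Real.exp_add]; ring_nf

/-- Turns L² closeness of states into closeness of forcings, as `sq_sub_le_of_forcing` requires. -/
lemma IsClassical.abs_integral_stress_sub_le {ν : Measure α}
    [IsProbabilityMeasure ν] {μ : ℝ} {f g : α → ℝ} {p q : α → ℝ → ℝ}
    (hp : IsClassical ν μ f p) (hq : IsClassical ν μ g q) {t c L C : ℝ} (ht : 0 < t) (hc : 0 ≤ c)
    (hL0 : 0 ≤ L) (hL : ∀ x y, |x| ≤ C → |y| ≤ C → |cubicStress x - cubicStress y| ≤ L * |x - y|)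
    (hpC : ∀ x, |p x t| ≤ C) (hqC : ∀ x, |q x t| ≤ C)
    (hle : eLpNorm (fun x => p x t - q x t) 2 ν ≤ ENNReal.ofReal c) :
    |∫ x, cubicStress (p x t) ∂ν - ∫ x, cubicStress (q x t) ∂ν| ≤ L * c := by
  have hm : MemLp (fun x => p x t - q x t) 2 ν := (hp.memLp ht).sub (hq.memLp ht)
  rw [← integral_sub (hp.integrable_stress ht) (hq.integrable_stress ht)]
  calc _ ≤ ∫ x, |cubicStress (p x t) - cubicStress (q x t)| ∂ν := abs_integral_le_integral_abs
    _ ≤ ∫ x, L * |p x t - q x t| ∂ν := by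
        refine integral_mono
          ((hp.integrable_stress ht).sub (hq.integrable_stress ht)).abs
          ((hm.integrable (by norm_num)).abs.const_mul L) fun x => hL _ _ (hpC x) (hqC x)
    _ = L * ∫ x, |p x t - q x t| ∂ν := integral_const_mul _ _
    _ ≤ L * c := mul_le_mul_of_nonneg_left (integral_abs_le_of_eLpNorm_two_le hm hc hle) hL0

/-- A pointwise limit of classical solutions satisfies the equation. -/
lemma hasDerivAt_of_tendsto {ν : Measure α}
    [IsProbabilityMeasure ν] {μ : ℝ} {f : ℕ → α → ℝ} {P : ℕ → α → ℝ → ℝ} {p : α → ℝ → ℝ}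
    (hP : ∀ n, IsClassical ν μ (f n) (P n))
    (hlim : ∀ x t, 0 < t → Tendsto (fun n => P n x t) atTop (𝓝 (p x t))) (x : α) {t : ℝ}
    (ht : 0 < t) :
    HasDerivAt (p x) ((∫ y, cubicStress (p y t) ∂ν) - cubicStress (p x t)) t := by
  have hbd : ∀ {τ : ℝ}, 0 < τ → ∀ x t, τ ≤ t → |p x t| ≤ |μ| + 4 + 4 / τ :=
    fun hτ x t ht => le_of_tendsto (hlim x t (hτ.trans_le ht)).abs
      (Eventually.of_forall fun n => (hP n).bound_of_le hτ x ht)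
  have hm : ∀ t, 0 < t → AEStronglyMeasurable (fun x => p x t) ν := fun t ht =>
    aestronglyMeasurable_of_tendsto_ae atTop (fun n => (hP n).aesm t ht)
      (ae_of_all _ fun x => hlim x t ht)
  set v : ℕ → ℝ → ℝ := fun n t => (∫ y, cubicStress (P n y t) ∂ν) - cubicStress (P n x t) with hv
  have hvB : ∀ {τ : ℝ}, 0 < τ → ∃ B, 0 ≤ B ∧ ∀ x n t, τ ≤ t →
      |(∫ y, cubicStress (P n y t) ∂ν) - cubicStress (P n x t)| ≤ B ∧
      |cubicStress (P n x t)| ≤ B := by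
    intro τ hτ
    obtain ⟨B, hB0, hB⟩ := exists_cubicStress_bound (|μ| + 4 + 4 / τ)
    refine ⟨B + B, by positivity, fun x n t ht => ⟨(abs_sub _ _).trans (add_le_add
      (abs_integral_le fun y => hB _ ((hP n).bound_of_le hτ y ht))
      (hB _ ((hP n).bound_of_le hτ x ht))), ?_⟩⟩
    linarith [hB _ ((hP n).bound_of_le hτ x ht)]
  have hcont : ∀ x, ContinuousOn (p x) (Ioi 0) := by
    intro x t ht
    have ht' : 0 < t := ht
    obtain ⟨B, hB0, hB⟩ := hvB (half_pos ht')
    -- A Lipschitz constant uniform in `n` survives the pointwise limit; continuity is needed before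
    -- the limit equation can be differentiated.
    have hLip : LipschitzOnWith (NNReal.mk B hB0) (p x) (Ici (t / 2)) := by
      refine LipschitzOnWith.of_dist_le_mul fun r hr s hs => ?_
      have hr' : 0 < r := (half_pos ht').trans_le hr
      have hs' : 0 < s := (half_pos ht').trans_le hs
      refine le_of_tendsto ((hlim x r hr').dist (hlim x s hs')) (Eventually.of_forall fun n => ?_)
      rw [dist_eq_norm, dist_eq_norm]
      exact (convex_Ici (t / 2)).norm_image_sub_le_of_norm_hasDerivWithin_le
        (fun u hu => ((hP n).deriv x u ((half_pos ht').trans_le hu)).hasDerivWithinAt)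
        (fun u hu => (hB x n u hu).1) hs hr
    exact (hLip.continuousOn.continuousAt
      (Ici_mem_nhds (by linarith : t / 2 < t))).continuousWithinAt
  have hNc := continuousOn_integral_comp hm hcont fun a b ha =>
    ⟨_, fun x t ht => hbd ha x t ht.1.le⟩
  have hNlim : ∀ t, 0 < t → Tendsto (fun n => ∫ y, cubicStress (P n y t) ∂ν) atTop
      (𝓝 (∫ y, cubicStress (p y t) ∂ν)) := by
    intro t ht
    obtain ⟨B, hB0, hB⟩ := hvB ht
    exact tendsto_integral_of_dominated_convergence (fun _ => B) (fun n => (hP n).aesm_stress ht)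
      (integrable_const _) (fun n => ae_of_all _ fun y => (hB y n t le_rfl).2)
      (ae_of_all _ fun y => (continuous_cubicStress.tendsto _).comp (hlim y t ht))
  refine hasDerivAt_of_integral_eq
    (v := fun t => (∫ y, cubicStress (p y t) ∂ν) - cubicStress (p x t))
    (hNc.sub (continuous_cubicStress.comp_continuousOn (hcont x))) ?_ ht
  intro s t hs ht
  have hpos : 0 < min s t := lt_min hs ht
  obtain ⟨B, hB0, hB⟩ := hvB hpos
  have hvc : ∀ n, ContinuousOn (v n) (Ioi 0) := fun n =>
    (continuousOn_integral_comp (hP n).aesm (hP n).continuousOn fun a b ha =>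
      ⟨_, fun x t ht => (hP n).bound_of_le ha x ht.1.le⟩).sub
      (continuous_cubicStress.comp_continuousOn ((hP n).continuousOn x))
  have hsub : ∀ r ∈ uIcc s t, 0 < r := fun r hr => hpos.trans_le hr.1
  have h1 : Tendsto (fun n => ∫ r in s..t, v n r) atTop
      (𝓝 (∫ r in s..t, ((∫ y, cubicStress (p y r) ∂ν) - cubicStress (p x r)))) := by
    refine intervalIntegral.tendsto_integral_filter_of_dominated_convergence (fun _ => B)
      (Eventually.of_forall fun n => ?_) (Eventually.of_forall fun n => ?_) (by simp) ?_
    · exact ((hvc n).mono fun r hr => hsub r (uIoc_subset_uIcc hr)).aestronglyMeasurable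
        measurableSet_uIoc
    · exact ae_of_all _ fun r hr => (hB x n r (uIoc_subset_uIcc hr).1).1
    · refine ae_of_all _ fun r hr => ?_
      have hr0 := hsub r (uIoc_subset_uIcc hr)
      exact (hNlim r hr0).sub ((continuous_cubicStress.tendsto _).comp (hlim x r hr0))
  have h2 : ∀ n, ∫ r in s..t, v n r = P n x t - P n x s := fun n =>
    intervalIntegral.integral_eq_sub_of_hasDerivAt (fun r hr => (hP n).deriv x r (hsub r hr))
      ((hvc n).mono fun r hr => hsub r hr).intervalIntegrable
  simp only [h2] at h1
  have h3 := tendsto_nhds_unique h1 ((hlim x t ht).sub (hlim x s hs))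
  rw [h3]
  ring

/-- Approximate the data with geometrically small errors. Summability gives a.e. convergence at the
countably many times `1 / (k + 1)`, hence off one null set. Since the forcings also converge,
convergence at such a time propagates along the trajectory to all later times, and so to every `t >
0`. Measurability of each time slice is recorded for the later use of Fubini. -/
theorem exists_isClassical {ν : Measure ℝ} [IsProbabilityMeasure ν] {μ : ℝ} {f : ℝ → ℝ}
    (hf : MemLp f 2 ν) (hfμ : ∫ x, f x ∂ν = μ) :
    ∃ p : ℝ → ℝ → ℝ, IsClassical ν μ f p ∧ ∀ t, 0 < t → Measurable fun x => p x t := by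
  classical
  set e : ℕ → ℝ := fun n => (1 / 2) ^ n with he
  have hepos : ∀ n, 0 < e n := fun n => by positivity
  have heanti : Antitone e := fun m n h => pow_le_pow_of_le_one (by norm_num) (by norm_num) h
  have helim : Tendsto e atTop (𝓝 0) :=
    tendsto_pow_atTop_nhds_zero_of_lt_one (by norm_num) (by norm_num)
  choose g hgμ hg using fun n => exists_boundedContinuous_approx hf
    (ENNReal.ofReal_pos.2 (hepos n)).ne'
  choose p hp hpc using fun n => exists_isClassical_of_bounded ν (g n)
  simp only [hgμ, hfμ] at hp
  have hgm : ∀ n, AEStronglyMeasurable (g n) ν := fun n =>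
    (g n).continuous.aestronglyMeasurable
  have hgg : ∀ N n m, N ≤ n → N ≤ m →
      eLpNorm (fun x => g n x - g m x) 2 ν ≤ ENNReal.ofReal (2 * e N) := by
    intro N n m hn hm
    have h1 : (fun x => g n x - g m x) = (fun x => f x - g m x) - fun x => f x - g n x := by
      ext x
      simp
    have m1 : ∀ n, AEStronglyMeasurable (fun x => f x - g n x) ν := fun n => hf.1.sub (hgm n)
    rw [h1, two_mul, ENNReal.ofReal_add (hepos N).le (hepos N).le]
    exact (eLpNorm_sub_le (m1 m) (m1 n) (by norm_num)).trans (add_le_add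
      ((hg m).trans (ENNReal.ofReal_le_ofReal (heanti hm)))
      ((hg n).trans (ENNReal.ofReal_le_ofReal (heanti hn))))
  have hpp : ∀ {t T : ℝ}, 0 < t → t ≤ T → ∀ N n m, N ≤ n → N ≤ m →
      eLpNorm (fun x => p n x t - p m x t) 2 ν ≤ ENNReal.ofReal (Real.exp T * (2 * e N)) := by
    intro t T ht htT N n m hn hm
    rw [ENNReal.ofReal_mul (Real.exp_pos T).le]
    exact ((hp n).eLpNorm_diff_le (hp m) (hgm n) (hgm m) ht).trans
      (mul_le_mul' (ENNReal.ofReal_le_ofReal (Real.exp_le_exp.2 htT)) (hgg N n m hn hm))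
  set τ : ℕ → ℝ := fun k => 1 / ((k : ℝ) + 1) with hτ
  have hτpos : ∀ k, 0 < τ k := fun k => by positivity
  set A : Set ℝ := {x | ∀ k, ∃ l, Tendsto (fun n => p n x (τ k)) atTop (𝓝 l)} with hA
  have hAm : MeasurableSet A := by
    rw [hA, ofPred_forall]
    exact MeasurableSet.iInter fun k =>
      measurableSet_exists_tendsto fun n => (hpc n (τ k)).measurable
  have hAae : ∀ᵐ x ∂ν, x ∈ A := by
    simp only [hA, mem_ofPred_eq]
    rw [ae_all_iff]
    intro k
    -- The factor 3 in place of 2 supplies the strict inequality required here.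
    refine Lp.ae_tendsto_of_cauchy_eLpNorm (p := 2)
      (B := fun N => ENNReal.ofReal (Real.exp (τ k) * (3 * e N)))
      (fun n => (hp n).aesm _ (hτpos k)) (by norm_num) ?_ ?_
    · refine (Summable.mul_left _ (Summable.mul_left _ ?_)).tsum_ofReal_ne_top
      exact summable_geometric_of_lt_one (by norm_num) (by norm_num)
    · intro N n m hn hm
      refine (hpp (hτpos k) le_rfl N n m hn hm).trans_lt
        ((ENNReal.ofReal_lt_ofReal_iff (by have := hepos N; positivity)).2 ?_)
      have := mul_pos (Real.exp_pos (τ k)) (hepos N)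
      nlinarith
  obtain ⟨x₀, hx₀⟩ := hAae.exists
  set ρ : ℝ → ℝ := fun x => if x ∈ A then x else x₀ with hρ
  have hρA : ∀ x, ρ x ∈ A := fun x => by
    by_cases hx : x ∈ A
    · simp [hρ, hx]
    · simpa [hρ, hx] using hx₀
  have hρae : ∀ᵐ x ∂ν, ρ x = x := by
    filter_upwards [hAae] with x hx
    simp [hρ, hx]
  have hρm : Measurable ρ := Measurable.ite hAm measurable_id measurable_const
  have hcauchy : ∀ x ∈ A, ∀ t, 0 < t → CauchySeq fun n => p n x t := by
    intro x hx t ht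
    obtain ⟨k, hk⟩ := exists_nat_one_div_lt ht
    obtain ⟨l, hl⟩ := hx k
    obtain ⟨b, hb0, hb, hblim⟩ := cauchySeq_iff_le_tendsto_0.1 hl.cauchySeq
    obtain ⟨L, hL0, hL⟩ := exists_cubicStress_lipschitz (|μ| + 4 + 4 / τ k)
    refine cauchySeq_of_le_tendsto_0
      (fun N => √(Real.exp (3 * (t - τ k)) *
        (b N ^ 2 + (L * (Real.exp t * (2 * e N))) ^ 2))) (fun n m N hn hm => ?_) ?_
    · refine Real.le_sqrt_of_sq_le ?_
      rw [Real.dist_eq, sq_abs]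
      refine (sq_sub_le_of_forcing (δ := L * (Real.exp t * (2 * e N))) (hτpos k) hk.le
        ((hp n).deriv x) ((hp m).deriv x) fun r hr => ?_).trans ?_
      · have hr0 := (hτpos k).trans_le hr.1
        exact (hp n).abs_integral_stress_sub_le (hp m) hr0
          (by have := hepos N; positivity) hL0 hL
          (fun x => (hp n).bound_of_le (hτpos k) x hr.1)
          (fun x => (hp m).bound_of_le (hτpos k) x hr.1) (hpp hr0 hr.2 N n m hn hm)
      · have h1 := hb n m N hn hm
        rw [Real.dist_eq] at h1
        have h2 : (p n x (τ k) - p m x (τ k)) ^ 2 ≤ b N ^ 2 :=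
          sq_le_sq' (abs_le.1 h1).1 (abs_le.1 h1).2
        gcongr
    · have h1 := ((hblim.pow 2).add
        ((((helim.const_mul 2).const_mul (Real.exp t)).const_mul L).pow 2)).const_mul
          (Real.exp (3 * (t - τ k)))
      simpa [Function.comp_def] using (Real.continuous_sqrt.tendsto _).comp h1
  set P : ℕ → ℝ → ℝ → ℝ := fun n x => p n (ρ x) with hPdef
  have hP : ∀ n, IsClassical ν μ (g n) (P n) := fun n => (hp n).comp_ae_id hρae
  have hPP : ∀ {t : ℝ}, 0 < t → ∀ N n m, N ≤ n → N ≤ m →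
      eLpNorm (fun x => P n x t - P m x t) 2 ν ≤ ENNReal.ofReal (Real.exp t * (2 * e N)) := by
    intro t ht N n m hn hm
    refine (eLpNorm_congr_ae ?_).trans_le (hpp ht le_rfl N n m hn hm)
    filter_upwards [hρae] with x hx
    simp only [hPdef, hx]
  set q : ℝ → ℝ → ℝ := fun x t => limUnder atTop fun n => P n x t with hq
  have hlim : ∀ x t, 0 < t → Tendsto (fun n => P n x t) atTop (𝓝 (q x t)) := fun x t ht =>
    CauchySeq.tendsto_limUnder (hcauchy _ (hρA x) t ht)
  have hqm : ∀ t, 0 < t → Measurable fun x => q x t := fun t ht =>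
    measurable_of_tendsto_metrizable (fun n => (hpc n t).measurable.comp hρm)
      (tendsto_pi_nhds.2 fun x => hlim x t ht)
  refine ⟨q, IsClassical.of_locally_bounded hf hfμ (fun t ht => (hqm t ht).aestronglyMeasurable)
    (fun x t ht => hasDerivAt_of_tendsto hP hlim x ht) ?_ ?_, hqm⟩
  · exact fun a b ha => ⟨|μ| + 4 + 4 / a, fun x t ht =>
      le_of_tendsto (hlim x t (ha.trans ht.1)).abs
        (Eventually.of_forall fun n => (hP n).bound_of_le ha x ht.1.le)⟩
  -- Lower semicontinuity of the L² norm gives an error uniform for `t ≤ 1`, so `n` can be fixed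
  -- before `t → 0⁺`.
  · have hqP : ∀ n t, 0 < t → t ≤ 1 → eLpNorm (fun x => q x t - P n x t) 2 ν
        ≤ ENNReal.ofReal (Real.exp 1 * (2 * e n)) := by
      intro n t ht ht1
      refine (Lp.eLpNorm_lim_le_liminf_eLpNorm (f := fun m x => P m x t - P n x t)
        (fun m => ((hP m).aesm t ht).sub ((hP n).aesm t ht)) _
        (ae_of_all _ fun x => (hlim x t ht).sub_const _)).trans ?_
      refine liminf_le_of_frequently_le' (Eventually.frequently ?_)
      filter_upwards [eventually_ge_atTop n] with m hm
      refine (hPP ht n m n hm le_rfl).trans (ENNReal.ofReal_le_ofReal ?_)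
      have := hepos n
      gcongr
    have hc : Tendsto (fun n => ENNReal.ofReal (Real.exp 1 * (2 * e n)) + ENNReal.ofReal (e n))
        atTop (𝓝 0) := by
      simpa using (ENNReal.tendsto_ofReal ((helim.const_mul 2).const_mul (Real.exp 1))).add
        (ENNReal.tendsto_ofReal helim)
    rw [ENNReal.tendsto_nhds_zero]
    intro ε hε
    obtain ⟨n, hn⟩ := ((ENNReal.tendsto_nhds_zero.1 hc) (ε / 2) (ENNReal.half_pos hε.ne')).exists
    filter_upwards [ENNReal.tendsto_nhds_zero.1 (hP n).initial (ε / 2) (ENNReal.half_pos hε.ne'),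
      Ioo_mem_nhdsGT (zero_lt_one (α := ℝ))] with t ht htI
    have h1 : (fun x => q x t - f x)
        = (fun x => q x t - P n x t) + (fun x => P n x t - g n x) - fun x => f x - g n x := by
      ext x
      simp
    have m1 : AEStronglyMeasurable (fun x => q x t - P n x t) ν :=
      (hqm t htI.1).aestronglyMeasurable.sub ((hP n).aesm t htI.1)
    have m2 : AEStronglyMeasurable (fun x => P n x t - g n x) ν :=
      ((hP n).aesm t htI.1).sub (hgm n)
    have m3 : AEStronglyMeasurable (fun x => f x - g n x) ν := hf.1.sub (hgm n)
    rw [h1]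
    calc _ ≤ (eLpNorm (fun x => q x t - P n x t) 2 ν + eLpNorm (fun x => P n x t - g n x) 2 ν)
          + eLpNorm (fun x => f x - g n x) 2 ν :=
          (eLpNorm_sub_le (m1.add m2) m3 (by norm_num)).trans
            (add_le_add_left (eLpNorm_add_le m1 m2 (by norm_num)) _)
      _ ≤ (ENNReal.ofReal (Real.exp 1 * (2 * e n)) + ε / 2) + ENNReal.ofReal (e n) :=
          add_le_add (add_le_add (hqP n t htI.1 htI.2.le) ht) (hg n)
      _ = (ENNReal.ofReal (Real.exp 1 * (2 * e n)) + ENNReal.ofReal (e n)) + ε / 2 := by ring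
      _ ≤ ε / 2 + ε / 2 := add_le_add_left hn _
      _ = ε := ENNReal.add_halves _

/-! ### Oscillating functions -/

/-- A continuous function that oscillates across `[a, b]` has late upcrossings of `[a, b]`. -/
lemma exists_upcrossing {f : ℝ → ℝ} (hf : ContinuousOn f (Ioi 0)) {a b : ℝ} (hab : a < b)
    (ha : ∃ᶠ t in atTop, f t < a) (hb : ∃ᶠ t in atTop, b < f t) {T : ℝ} (hT : 0 < T) :
    ∃ u v, T ≤ u ∧ u ≤ v ∧ (∀ t ∈ Icc u v, a ≤ f t) ∧ Icc a b ⊆ f '' Icc u v := by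
  obtain ⟨T₁, hT₁, h₁⟩ := frequently_atTop.1 ha T
  obtain ⟨v, hv, h₂⟩ := frequently_atTop.1 hb T₁
  have hfc : ContinuousOn f (Icc T₁ v) := hf.mono fun t ht => hT.trans_le (hT₁.trans ht.1)
  set S : Set ℝ := Icc T₁ v ∩ f ⁻¹' Iic a with hS
  have hSc : IsCompact S :=
    isCompact_Icc.of_isClosed_subset (hfc.preimage_isClosed_of_isClosed isClosed_Icc isClosed_Iic)
      inter_subset_left
  obtain ⟨⟨hu1, hu2⟩, hu3⟩ := hSc.sSup_mem ⟨T₁, left_mem_Icc.2 hv, h₁.le⟩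
  set u := sSup S
  have hgt : ∀ t ∈ Ioc u v, a < f t := by
    intro t ht
    by_contra! h
    exact absurd (le_csSup hSc.bddAbove (⟨⟨hu1.trans ht.1.le, ht.2⟩, h⟩ : t ∈ S)) (not_le.2 ht.1)
  have hfu : ContinuousOn f (Icc u v) := hfc.mono (Icc_subset_Icc_left hu1)
  have hsub : Icc a b ⊆ f '' Icc u v := fun s hs =>
    intermediate_value_Icc hu2 hfu ⟨(show f u ≤ a from hu3).trans hs.1, hs.2.trans h₂.le⟩
  refine ⟨u, v, hT₁.trans hu1, hu2, fun t ht => ?_, hsub⟩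
  -- At the last time `u` with `f ≤ a`, equality holds: the value `a` is attained on `[u, v]`, and
  -- `f > a` after `u`.
  rcases ht.1.eq_or_lt with rfl | h
  · obtain ⟨r, hr, hfr⟩ := hsub (left_mem_Icc.2 hab.le)
    rcases hr.1.eq_or_lt with h | h
    · rw [h, hfr]
    · exact absurd (hgt r ⟨h, hr.2⟩) (by rw [hfr]; exact lt_irrefl _)
  · exact (hgt t ⟨h, ht.2⟩).le

lemma exists_tendsto_of_abs_le {f : ℝ → ℝ} {C : ℝ} (hC : ∀ t, 1 ≤ t → |f t| ≤ C)
    (h : ∀ a b, a < b → (∃ᶠ t in atTop, f t < a) → (∃ᶠ t in atTop, b < f t) → False) :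
    ∃ l, Tendsto f atTop (𝓝 l) := by
  refine tendsto_of_no_upcrossings (s := univ) dense_univ
    (fun a _ b _ hab hcon => h a b hab hcon.1 hcon.2) ?_ ?_
  · refine isBoundedUnder_of_eventually_le (a := C) ?_
    filter_upwards [eventually_ge_atTop 1] with t ht using (abs_le.1 (hC t ht)).2
  · refine isBoundedUnder_of_eventually_ge (a := -C) ?_
    filter_upwards [eventually_ge_atTop 1] with t ht using (abs_le.1 (hC t ht)).1

/-- A bounded continuous function whose stress converges is itself convergent. -/
lemma exists_tendsto_of_tendsto_cubicStress {f : ℝ → ℝ} {C s : ℝ} (hf : ContinuousOn f (Ioi 0))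
    (hC : ∀ t, 1 ≤ t → |f t| ≤ C) (hs : Tendsto (fun t => cubicStress (f t)) atTop (𝓝 s)) :
    ∃ l, Tendsto f atTop (𝓝 l) := by
  refine exists_tendsto_of_abs_le hC fun a b hab ha hb => ?_
  -- Each level between `a` and `b` is taken at arbitrarily late times, so a nonconstant cubic would
  -- be constant on an interval.
  have hσ : ∀ c ∈ Icc a b, cubicStress c = s := by
    intro c hc
    by_contra hne
    obtain ⟨T, hT⟩ := eventually_atTop.1 (hs.eventually_ne (Ne.symm hne))
    obtain ⟨u, v, hu, -, -, hsub⟩ := exists_upcrossing hf hab ha hb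
      (lt_max_of_lt_right one_pos : 0 < max T 1)
    obtain ⟨t, ht, rfl⟩ := hsub hc
    exact hT t ((le_max_left _ _).trans (hu.trans ht.1)) rfl
  have := leading_coeff_eq_zero_of_progression (a := 1) (b := 0) (c := -1) (d := -s) (z := a)
    (h := (b - a) / 3) (div_ne_zero (sub_pos.2 hab).ne' (by norm_num)) ?_
  · exact one_ne_zero this
  · intro j hj
    have hj' : (j : ℝ) ≤ 3 := by exact_mod_cast hj
    have := hσ (a + j * ((b - a) / 3)) ⟨by
      have : 0 ≤ (j : ℝ) * ((b - a) / 3) := mul_nonneg j.cast_nonneg (by linarith)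
      linarith, by nlinarith⟩
    unfold cubicStress at this
    linarith

/-! ### Roots of the cubic and exclusion of oscillation -/

lemma cubicStress_le_of_one_le {a b : ℝ} (ha : 1 ≤ a) (hab : a ≤ b) :
    cubicStress a ≤ cubicStress b := by
  have h : cubicStress b - cubicStress a = (b - a) * (a ^ 2 + a * b + b ^ 2 - 1) := by
    unfold cubicStress; ring
  have h2 : 0 ≤ a ^ 2 + a * b + b ^ 2 - 1 := by nlinarith
  linarith [mul_nonneg (sub_nonneg.2 hab) h2]

lemma exists_cubicStress_eq {s : ℝ} (hs : 0 < s) : ∃ z, 1 < z ∧ cubicStress z = s := by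
  have h := intermediate_value_Icc (f := cubicStress) (by linarith : (1 : ℝ) ≤ 1 + s)
    continuous_cubicStress.continuousOn
  obtain ⟨z, hz, hzs⟩ := h (show s ∈ Icc (cubicStress 1) (cubicStress (1 + s)) by
    unfold cubicStress
    constructor <;> nlinarith [pow_pos hs 2, pow_pos hs 3])
  refine ⟨z, lt_of_le_of_ne hz.1 ?_, hzs⟩
  rintro rfl
  norm_num [cubicStress] at hzs
  linarith

/-- Up to a multiple of the stress difference, `q² + zq + z² - 1` is the indicator of `q > 0`
times its value at the outer root `z`. -/
lemma abs_quadratic_sub_indicator_le {C z q : ℝ} (hz : 1 < z) (hq : |q| ≤ C) :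
    |q ^ 2 + z * q + z ^ 2 - 1 - (if 0 < q then 1 else 0) * (3 * z ^ 2 - 1)|
      ≤ ((C + 2 * z) / (z ^ 2 - 1) + 1) * |cubicStress q - cubicStress z| := by
  have hz2 : 0 < z ^ 2 - 1 := by nlinarith
  have hC : 0 ≤ C := (abs_nonneg _).trans hq
  have hfac : |cubicStress q - cubicStress z| = |q - z| * |q ^ 2 + z * q + z ^ 2 - 1| := by
    rw [← abs_mul]
    congr 1
    unfold cubicStress; ring
  -- Here `σ(q) - σ(z) = (q - z)(q² + zq + z² - 1)`. For `q > 0` the quadratic factor is at least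
  -- `z² - 1`, which controls `q - z`; for `q ≤ 0` the linear factor is at least 1 in modulus, which
  -- controls the quadratic.
  split_ifs with h
  · have e : q ^ 2 + z * q + z ^ 2 - 1 - 1 * (3 * z ^ 2 - 1) = (q - z) * (q + 2 * z) := by ring
    have h1 : z ^ 2 - 1 ≤ |q ^ 2 + z * q + z ^ 2 - 1| :=
      (le_abs_self _).trans' (by nlinarith)
    have h2 : |q + 2 * z| ≤ C + 2 * z := by
      rw [abs_of_pos (by linarith)]
      linarith [le_abs_self q]
    have h3 : (z ^ 2 - 1) * |q - z| ≤ |cubicStress q - cubicStress z| := by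
      rw [hfac, mul_comm]
      exact mul_le_mul_of_nonneg_left h1 (abs_nonneg _)
    rw [e, abs_mul]
    calc |q - z| * |q + 2 * z| ≤ |q - z| * (C + 2 * z) := by gcongr
      _ = (C + 2 * z) / (z ^ 2 - 1) * ((z ^ 2 - 1) * |q - z|) := by field_simp
      _ ≤ (C + 2 * z) / (z ^ 2 - 1) * |cubicStress q - cubicStress z| := by gcongr
      _ ≤ _ := by gcongr; linarith
  · have h1 : 1 ≤ |q - z| := by
      rw [abs_of_neg (by linarith)]
      linarith
    rw [zero_mul, sub_zero]
    calc |q ^ 2 + z * q + z ^ 2 - 1| ≤ |q - z| * |q ^ 2 + z * q + z ^ 2 - 1| :=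
          le_mul_of_one_le_left (abs_nonneg _) h1
      _ = |cubicStress q - cubicStress z| := hfac.symm
      _ ≤ _ := le_mul_of_one_le_left (abs_nonneg _)
          (by have : 0 ≤ (C + 2 * z) / (z ^ 2 - 1) := by positivity
              linarith)

/-- If the state follows the stress level `N` quasi-statically and its second moment is
asymptotically an affine function of `N` with slope the mean `μ`, then persistent oscillation of
`N` across positive levels forces `μ = 0`. -/
lemma mean_eq_zero_of_oscillation {ν : Measure α} [IsProbabilityMeasure ν] {p : α → ℝ → ℝ} {N : ℝ → ℝ} {μ K C a b : ℝ}
    (hm : ∀ t, 0 < t → AEStronglyMeasurable (fun x => p x t) ν)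
    (hc : ∀ x, ContinuousOn (p x) (Ioi 0)) (hC : ∀ x t, 1 ≤ t → |p x t| ≤ C)
    (hmean : ∀ t, 0 < t → ∫ x, p x t ∂ν = μ) (hN : ContinuousOn N (Ioi 0))
    (hg : ∀ᵐ x ∂ν, Tendsto (fun t => cubicStress (p x t) - N t) atTop (𝓝 0))
    (hK : Tendsto (fun t => ∫ x, p x t ^ 2 ∂ν - μ * N t) atTop (𝓝 K))
    (hab : a < b) (hb0 : 0 < b) (ha : ∃ᶠ t in atTop, N t < a) (hb : ∃ᶠ t in atTop, b < N t) :
    μ = 0 := by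
  -- Raising the lower level makes all crossed levels positive, with an outer root `z > 1`.
  set s₁ := max a (b / 2) with hs₁
  have hs₁0 : 0 < s₁ := lt_max_of_lt_right (by positivity)
  have hs₁b : s₁ < b := max_lt hab (by linarith)
  have ha' : ∃ᶠ t in atTop, N t < s₁ := ha.mono fun t ht => ht.trans_le (le_max_left _ _)
  have hup := fun k : ℕ => exists_upcrossing hN hs₁b ha' hb (by positivity : 0 < (k : ℝ) + 1)
  choose u v hu huv hlow hval using hup
  have hu1 : ∀ k, 1 ≤ u k := fun k => by linarith [hu k, k.cast_nonneg (α := ℝ)]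
  have hutop : Tendsto u atTop atTop := by
    refine tendsto_atTop_mono (fun k => ?_) tendsto_natCast_atTop_atTop
    linarith [hu k]
  let I : ℝ → ℝ := fun t => ∫ x, (if 0 < p x t then (1 : ℝ) else 0) ∂ν
  have hind : ∀ t, 0 < t → AEStronglyMeasurable (fun x => if 0 < p x t then (1 : ℝ) else 0) ν := by
    intro t ht
    have : Measurable fun r : ℝ => if 0 < r then (1 : ℝ) else 0 :=
      Measurable.ite measurableSet_Ioi measurable_const measurable_const
    exact (this.comp_aemeasurable (hm t ht).aemeasurable).aestronglyMeasurable
  have hind1 : ∀ x t, |if 0 < p x t then (1 : ℝ) else 0| ≤ 1 := by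
    intro x t
    split_ifs <;> simp
  -- Integrate the quadratic in `p` at times with `N = σ(z)`: the second moment tends to `μ σ(z) +
  -- K`, the first moment is `μ`, and the quadratic is asymptotically `3z² - 1` times the indicator
  -- of `p > 0`.
  have hI : ∀ z, 1 < z → ∀ τ : ℕ → ℝ, (∀ k, τ k ∈ Icc (u k) (v k)) →
      (∀ k, N (τ k) = cubicStress z) →
      Tendsto (fun k => I (τ k)) atTop
        (𝓝 ((μ * z ^ 3 + z ^ 2 + K - 1) / (3 * z ^ 2 - 1))) := by
    intro z hz τ hτ hτN
    have hτ1 : ∀ k, 1 ≤ τ k := fun k => (hu1 k).trans (hτ k).1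
    have hτ0 : ∀ k, 0 < τ k := fun k => one_pos.trans_le (hτ1 k)
    have hτtop : Tendsto τ atTop atTop := tendsto_atTop_mono (fun k => (hτ k).1) hutop
    have hz3 : 0 < 3 * z ^ 2 - 1 := by nlinarith
    have hz2 : 0 < z ^ 2 - 1 := by nlinarith
    have hp1 : ∀ k, Integrable (fun x => p x (τ k)) ν := fun k =>
      integrable_of_abs_le (hm _ (hτ0 k)) fun x => hC x _ (hτ1 k)
    have hp2 : ∀ k, Integrable (fun x => p x (τ k) ^ 2) ν := fun k =>
      (memLp_two_of_abs_le (hm _ (hτ0 k)) fun x => hC x _ (hτ1 k)).integrable_sq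
    have hii : ∀ k, Integrable (fun x => if 0 < p x (τ k) then (1 : ℝ) else 0) ν := fun k =>
      integrable_of_abs_le (hind _ (hτ0 k)) fun x => hind1 x _
    let J : ℕ → α → ℝ := fun k x => p x (τ k) ^ 2 + z * p x (τ k) + z ^ 2 - 1
      - (if 0 < p x (τ k) then 1 else 0) * (3 * z ^ 2 - 1)
    have hJint : ∀ k, ∫ x, J k x ∂ν
        = ∫ x, p x (τ k) ^ 2 ∂ν + z * μ + z ^ 2 - 1 - I (τ k) * (3 * z ^ 2 - 1) := by
      intro k
      have i1 : Integrable (fun x => p x (τ k) ^ 2 + z * p x (τ k)) ν :=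
        (hp2 k).add ((hp1 k).const_mul z)
      have i2 : Integrable (fun x => p x (τ k) ^ 2 + z * p x (τ k) + z ^ 2) ν :=
        i1.add (integrable_const _)
      have i3 : Integrable (fun x => p x (τ k) ^ 2 + z * p x (τ k) + z ^ 2 - 1) ν :=
        i2.sub (integrable_const _)
      simp only [J]
      rw [integral_sub i3 ((hii k).mul_const _), integral_sub i2 (integrable_const _),
        integral_add i1 (integrable_const _), integral_add (hp2 k) ((hp1 k).const_mul z),
        integral_const_mul, integral_mul_const, hmean _ (hτ0 k)]
      simp [I]
    have hJ0 : Tendsto (fun k => ∫ x, J k x ∂ν) atTop (𝓝 (∫ _, (0 : ℝ) ∂ν)) := by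
      obtain ⟨B, hB0, hB⟩ := exists_cubicStress_bound C
      set M := (C + 2 * z) / (z ^ 2 - 1) + 1 with hM
      have hJle : ∀ k x, |J k x| ≤ M * |cubicStress (p x (τ k)) - cubicStress z| := fun k x =>
        abs_quadratic_sub_indicator_le hz (hC x _ (hτ1 k))
      have hC0 : ∀ x : α, 0 ≤ C := fun x => (abs_nonneg _).trans (hC x 1 le_rfl)
      refine tendsto_integral_of_dominated_convergence
        (fun _ => |M| * (B + |cubicStress z|)) (fun k => ?_) (integrable_const _)
        (fun k => ae_of_all _ fun x => ?_) ?_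
      · exact ((((((hm _ (hτ0 k)).pow 2).add ((hm _ (hτ0 k)).const_mul z)).add
          aestronglyMeasurable_const).sub aestronglyMeasurable_const).sub
          ((hind _ (hτ0 k)).mul_const _))
      · refine (hJle k x).trans ?_
        have h1 : |cubicStress (p x (τ k)) - cubicStress z| ≤ B + |cubicStress z| :=
          (abs_sub _ _).trans (add_le_add (hB _ (hC x _ (hτ1 k))) le_rfl)
        gcongr
        exact le_abs_self _
      · filter_upwards [hg] with x hx
        have h1 := (hx.comp hτtop).abs.const_mul M
        simp only [Function.comp_def, hτN, abs_zero, mul_zero] at h1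
        exact squeeze_zero_norm (fun k => hJle k x) h1
    have h2 := hK.comp hτtop
    simp only [Function.comp_def, hτN] at h2
    have h3 := (((h2.add_const (μ * cubicStress z + z * μ + z ^ 2 - 1)).sub hJ0).div_const
      (3 * z ^ 2 - 1))
    have h4 : (K + (μ * cubicStress z + z * μ + z ^ 2 - 1) - ∫ _ : α, (0 : ℝ) ∂ν)
        / (3 * z ^ 2 - 1) = (μ * z ^ 3 + z ^ 2 + K - 1) / (3 * z ^ 2 - 1) := by
      rw [integral_zero]
      unfold cubicStress
      congr 1
      ring
    rw [h4] at h3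
    refine h3.congr fun k => ?_
    rw [hJint, div_eq_iff hz3.ne']
    ring
  -- Within a late crossing `N ≥ s₁ > 0`, while a zero of `p(x,·)` would give `σ(p) - N ≤ -s₁`. So
  -- almost every trajectory eventually keeps its sign during each crossing.
  have hII : ∀ τ τ' : ℕ → ℝ, (∀ k, τ k ∈ Icc (u k) (v k)) → (∀ k, τ' k ∈ Icc (u k) (v k)) →
      Tendsto (fun k => I (τ k) - I (τ' k)) atTop (𝓝 0) := by
    intro τ τ' hτ hτ'
    have hpos : ∀ k, ∀ t ∈ Icc (u k) (v k), 0 < t := fun k t ht =>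
      one_pos.trans_le ((hu1 k).trans ht.1)
    have h : Tendsto (fun k => ∫ x, ((if 0 < p x (τ k) then (1 : ℝ) else 0)
        - (if 0 < p x (τ' k) then 1 else 0)) ∂ν) atTop (𝓝 (∫ _, (0 : ℝ) ∂ν)) := by
      refine tendsto_integral_of_dominated_convergence (fun _ => 1 + 1)
        (fun k => (hind _ (hpos k _ (hτ k))).sub (hind _ (hpos k _ (hτ' k))))
        (integrable_const _)
        (fun k => ae_of_all _ fun x => (abs_sub _ _).trans
          (add_le_add (hind1 x _) (hind1 x _))) ?_
      filter_upwards [hg] with x hx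
      obtain ⟨T, hT⟩ := eventually_atTop.1 (hx.eventually (lt_mem_nhds (neg_neg_of_pos hs₁0)))
      refine tendsto_const_nhds.congr' ?_
      filter_upwards [hutop.eventually_ge_atTop T] with k hk
      have hne : ∀ t ∈ Icc (u k) (v k), p x t ≠ 0 := by
        intro t ht h0
        have h1 := hT t (hk.trans ht.1)
        have h2 := hlow k t ht
        rw [h0] at h1
        norm_num [cubicStress] at h1
        linarith
      have hsgn : ∀ r ∈ Icc (u k) (v k), ∀ s ∈ Icc (u k) (v k), 0 < p x r → 0 < p x s := by
        intro r hr s hs h1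
        by_contra! h2
        have hsub : uIcc s r ⊆ Icc (u k) (v k) := uIcc_subset_Icc hs hr
        have h3 := intermediate_value_uIcc ((hc x).mono fun t ht => hpos k t (hsub ht))
        obtain ⟨t, ht, ht0⟩ := h3 (show (0 : ℝ) ∈ uIcc (p x s) (p x r) from
          mem_uIcc.2 (Or.inl ⟨h2, h1.le⟩))
        exact hne t (hsub ht) ht0
      have hiff : 0 < p x (τ k) ↔ 0 < p x (τ' k) :=
        ⟨hsgn _ (hτ k) _ (hτ' k), hsgn _ (hτ' k) _ (hτ k)⟩
      simp [hiff]
    rw [integral_zero] at h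
    refine h.congr fun k => integral_sub ?_ ?_
    · exact integrable_of_abs_le (hind _ (hpos k _ (hτ k))) fun x => hind1 x _
    · exact integrable_of_abs_le (hind _ (hpos k _ (hτ' k))) fun x => hind1 x _
  obtain ⟨z₁, hz₁, hσ₁⟩ := exists_cubicStress_eq hs₁0
  obtain ⟨z₂, hz₂, hσ₂⟩ := exists_cubicStress_eq hb0
  have hz₁₂ : z₁ < z₂ := by
    by_contra! h
    have := cubicStress_le_of_one_le hz₂.le h
    linarith
  have hτex : ∀ z ∈ Icc z₁ z₂, ∃ τ : ℕ → ℝ, (∀ k, τ k ∈ Icc (u k) (v k)) ∧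
      ∀ k, N (τ k) = cubicStress z := by
    intro z hz
    have hmem : cubicStress z ∈ Icc s₁ b := by
      rw [← hσ₁, ← hσ₂]
      exact ⟨cubicStress_le_of_one_le hz₁.le hz.1,
        cubicStress_le_of_one_le (hz₁.le.trans hz.1) hz.2⟩
    choose τ hτ hτN using fun k => hval k hmem
    exact ⟨τ, hτ, hτN⟩
  obtain ⟨τ₁, hτ₁, hτN₁⟩ := hτex z₁ (left_mem_Icc.2 hz₁₂.le)
  set c := (μ * z₁ ^ 3 + z₁ ^ 2 + K - 1) / (3 * z₁ ^ 2 - 1) with hcdef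
  -- The limiting fraction at `z` equals its value `c` at `z₁`; clearing denominators leaves a cubic
  -- with leading coefficient `μ`.
  have hcz : ∀ z ∈ Icc z₁ z₂, μ * z ^ 3 + (1 - 3 * c) * z ^ 2 + 0 * z + (K - 1 + c) = 0 := by
    intro z hz
    have hz1 : 1 < z := hz₁.trans_le hz.1
    obtain ⟨τ, hτ, hτN⟩ := hτex z hz
    have h1 := tendsto_nhds_unique
      ((hI z hz1 τ hτ hτN).sub (hI z₁ hz₁ τ₁ hτ₁ hτN₁)) (hII τ τ₁ hτ hτ₁)
    have hz3 : 3 * z ^ 2 - 1 ≠ 0 := by nlinarith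
    rw [sub_eq_zero, ← hcdef, div_eq_iff hz3] at h1
    linarith
  refine leading_coeff_eq_zero_of_progression (z := z₁) (h := (z₂ - z₁) / 3)
    (div_ne_zero (sub_pos.2 hz₁₂).ne' (by norm_num)) fun j hj => hcz _ ?_
  have hj' : (j : ℝ) ≤ 3 := by exact_mod_cast hj
  have hd : 0 ≤ (j : ℝ) * ((z₂ - z₁) / 3) := mul_nonneg j.cast_nonneg (by linarith)
  exact ⟨by linarith, by nlinarith⟩

/-! ### Asymptotic behaviour -/

lemma exists_bound_of_continuous {φ : ℝ → ℝ} (hφ : Continuous φ) (C : ℝ) :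
    ∃ B, 0 ≤ B ∧ ∀ r, |r| ≤ C → |φ r| ≤ B := by
  obtain ⟨B, hB⟩ := (isCompact_Icc (a := -C) (b := C)).exists_bound_of_continuousOn
    hφ.continuousOn
  exact ⟨max B 0, le_max_right _ _, fun x hx => (hB x (abs_le.1 hx)).trans (le_max_left _ _)⟩

section Asymptotics

variable {ν : Measure α} [IsProbabilityMeasure ν] {μ : ℝ}
  {f : α → ℝ} {p : α → ℝ → ℝ}

lemma IsClassical.integrable_comp (hp : IsClassical ν μ f p) {φ : ℝ → ℝ} (hφ : Continuous φ)
    {t : ℝ} (ht : 0 < t) : Integrable (fun x => φ (p x t)) ν := by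
  obtain ⟨B, -, hB⟩ := exists_bound_of_continuous hφ (|μ| + 4 + 4 / t)
  exact integrable_of_abs_le (hφ.comp_aestronglyMeasurable (hp.aesm t ht))
    fun x => hB _ (hp.bound x t ht)

lemma IsClassical.hasDerivAt_integral_comp (hp : IsClassical ν μ f p) {φ φ' : ℝ → ℝ}
    (hφ : ∀ r, HasDerivAt φ (φ' r) r) (hφ' : Continuous φ') {t : ℝ} (ht : 0 < t) :
    HasDerivAt (fun t => ∫ x, φ (p x t) ∂ν)
      (∫ x, φ' (p x t) * ((∫ y, cubicStress (p y t) ∂ν) - cubicStress (p x t)) ∂ν) t := by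
  have hφc : Continuous φ := continuous_iff_continuousAt.2 fun r => (hφ r).continuousAt
  set C := |μ| + 4 + 4 / (t / 2)
  have hpC : ∀ x, ∀ s ∈ Ioo (t / 2) (2 * t), |p x s| ≤ C := fun x s hs =>
    hp.bound_of_le (by positivity) x hs.1.le
  obtain ⟨B, hB0, hB⟩ := exists_cubicStress_bound C
  obtain ⟨B', hB'0, hB'⟩ := exists_bound_of_continuous hφ' C
  have hpos : ∀ s ∈ Ioo (t / 2) (2 * t), 0 < s := fun s hs => by linarith [hs.1]
  refine hasDerivAt_integral_of_abs_le (C := B' * (B + B)) (F := fun x s => φ (p x s))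
    (F' := fun x s => φ' (p x s) * ((∫ y, cubicStress (p y s) ∂ν) - cubicStress (p x s)))
    (a := t / 2) (b := 2 * t) ⟨by linarith, by linarith⟩
    (fun s hs => hφc.comp_aestronglyMeasurable (hp.aesm s (hpos s hs)))
    ((hφ'.comp_aestronglyMeasurable (hp.aesm t ht)).mul
      (aestronglyMeasurable_const.sub (hp.aesm_stress ht)))
    (hp.integrable_comp hφc ht)
    (fun x s hs => (hφ (p x s)).comp s (hp.deriv x s (hpos s hs))) fun x s hs => ?_
  rw [abs_mul]
  have h1 := hB' _ (hpC x s hs)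
  have h2 := (abs_sub (∫ y, cubicStress (p y s) ∂ν) (cubicStress (p x s))).trans
    (add_le_add (abs_integral_le fun y => hB _ (hpC y s hs)) (hB _ (hpC x s hs)))
  gcongr

lemma IsClassical.continuousOn_integral_stress (hp : IsClassical ν μ f p) :
    ContinuousOn (fun t => ∫ y, cubicStress (p y t) ∂ν) (Ioi 0) := fun _ ht =>
  (hp.hasDerivAt_integral_comp hasDerivAt_cubicStress (by fun_prop)
    ht).continuousAt.continuousWithinAt

lemma IsClassical.hasDerivAt_energy (hp : IsClassical ν μ f p) {t : ℝ} (ht : 0 < t) :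
    HasDerivAt (fun t => ∫ x, (p x t ^ 4 / 4 - p x t ^ 2 / 2) ∂ν)
      (-∫ x, (cubicStress (p x t) - ∫ y, cubicStress (p y t) ∂ν) ^ 2 ∂ν) t := by
  have hW : ∀ r : ℝ, HasDerivAt (fun r : ℝ => r ^ 4 / 4 - r ^ 2 / 2) (cubicStress r) r := by
    intro r
    refine (((hasDerivAt_pow 4 r).div_const 4).fun_sub
      ((hasDerivAt_pow 2 r).div_const 2)).congr_deriv ?_
    unfold cubicStress
    norm_num
  refine (hp.hasDerivAt_integral_comp hW continuous_cubicStress ht).congr_deriv ?_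
  set N := ∫ y, cubicStress (p y t) ∂ν with hN
  have i1 := hp.integrable_stress ht
  have i2 : Integrable (fun x => (cubicStress (p x t) - N) ^ 2) ν :=
    hp.integrable_comp (φ := fun r => (cubicStress r - N) ^ 2)
      ((continuous_cubicStress.sub continuous_const).pow 2) ht
  -- Adding this null term completes the square in `σ(p)(N - σ(p))`.
  have h0 : ∫ x, N * (N - cubicStress (p x t)) ∂ν = 0 := by
    rw [integral_const_mul, integral_sub (integrable_const _) i1]
    simp [hN]
  have i3 : Integrable (fun x => N * (N - cubicStress (p x t))) ν :=
    ((integrable_const N).sub i1).const_mul N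
  have i2' : Integrable (fun x => -(cubicStress (p x t) - N) ^ 2) ν := i2.neg
  rw [← integral_neg, ← add_zero (∫ x, -(cubicStress (p x t) - N) ^ 2 ∂ν), ← h0,
    ← integral_add i2' i3]
  refine integral_congr_ae (ae_of_all _ fun x => ?_)
  ring

/-- The energy is nonincreasing, and its density `((r² - 1)² - 1)/4` is at least `-1/4`. -/
lemma IsClassical.exists_tendsto_energy (hp : IsClassical ν μ f p) :
    ∃ W, Tendsto (fun t => ∫ x, (p x t ^ 4 / 4 - p x t ^ 2 / 2) ∂ν) atTop (𝓝 W) := by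
  set V : ℝ → ℝ := fun t => ∫ x, (p x t ^ 4 / 4 - p x t ^ 2 / 2) ∂ν with hV
  have hd := fun {t : ℝ} (ht : 0 < t) => hp.hasDerivAt_energy ht
  have hanti : AntitoneOn V (Ici 1) := by
    refine antitoneOn_of_deriv_nonpos (convex_Ici 1)
      (fun t ht => (hd (one_pos.trans_le ht)).continuousAt.continuousWithinAt) ?_ ?_
    · rw [interior_Ici]
      exact fun t ht => (hd (one_pos.trans ht)).differentiableAt.differentiableWithinAt
    · rw [interior_Ici]
      intro t ht
      rw [(hd (one_pos.trans ht)).deriv, neg_nonpos]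
      exact integral_nonneg fun x => sq_nonneg _
  have hanti' : Antitone fun t => V (max t 1) := fun s t hst =>
    hanti (le_max_right s 1) (le_max_right t 1) (max_le_max_right 1 hst)
  have hbdd : BddBelow (range fun t => V (max t 1)) := by
    refine ⟨-1 / 4, ?_⟩
    rintro _ ⟨t, rfl⟩
    have h1 : ∫ _ : α, (-1 / 4 : ℝ) ∂ν ≤ V (max t 1) := by
      refine integral_mono (integrable_const _)
        (hp.integrable_comp (φ := fun r => r ^ 4 / 4 - r ^ 2 / 2) (by fun_prop)
          (one_pos.trans_le (le_max_right t 1))) fun x => ?_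
      nlinarith [sq_nonneg (p x (max t 1) ^ 2 - 1)]
    simpa using h1
  refine ⟨_, (tendsto_atTop_ciInf hanti' hbdd).congr' ?_⟩
  filter_upwards [eventually_ge_atTop 1] with t ht
  rw [max_eq_left ht]

/-- The dissipation is integrable in time along almost every trajectory. -/
lemma IsClassical.ae_integrableOn_sq (hp : IsClassical ν μ f p)
    (hm : ∀ t, 0 < t → Measurable fun x => p x t) :
    ∀ᵐ x ∂ν, IntegrableOn
      (fun t => (cubicStress (p x t) - ∫ y, cubicStress (p y t) ∂ν) ^ 2) (Ioi 1) := by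
  obtain ⟨W, hW⟩ := hp.exists_tendsto_energy
  set N : ℝ → ℝ := fun t => ∫ y, cubicStress (p y t) ∂ν with hN
  have hD : IntegrableOn (fun t => -∫ x, (cubicStress (p x t) - N t) ^ 2 ∂ν) (Ioi 1) :=
    integrableOn_Ioi_deriv_of_nonpos
      (hp.hasDerivAt_energy one_pos).continuousAt.continuousWithinAt
      (fun t ht => hp.hasDerivAt_energy (one_pos.trans ht))
      (fun t _ => neg_nonpos.2 (integral_nonneg fun x => sq_nonneg _)) hW
  -- Freezing time before 1 makes the integrand continuous in `t` on all of `ℝ`; with measurable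
  -- slices it is jointly measurable, so Fubini applies to the finite total dissipation.
  let h : ℝ → α → ℝ := fun t x => (cubicStress (p x (max t 1)) - N (max t 1)) ^ 2
  have hi : ∀ s, 0 < s → Integrable (fun x => (cubicStress (p x s) - N s) ^ 2) ν := fun s hs =>
    hp.integrable_comp (φ := fun r => (cubicStress r - N s) ^ 2)
      ((continuous_cubicStress.sub continuous_const).pow 2) hs
  have hmax : ∀ t : ℝ, 0 < max t 1 := fun t => lt_max_of_lt_right one_pos
  have hmaxc : Continuous fun t : ℝ => max t 1 := continuous_id.max continuous_const
  have hmeas : Measurable (Function.uncurry h) := by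
    refine measurable_uncurry_of_continuous_of_measurable (fun x => ?_) (fun t => ?_)
    · have h1 := (hp.continuousOn x).comp_continuous hmaxc hmax
      have h2 := hp.continuousOn_integral_stress.comp_continuous hmaxc hmax
      exact ((continuous_cubicStress.comp h1).sub h2).pow 2
    · have h1 : Measurable fun x => cubicStress (p x (max t 1)) :=
        continuous_cubicStress.measurable.comp (hm _ (hmax t))
      exact (h1.sub_const (N (max t 1))).pow_const 2
  have hint : Integrable (Function.uncurry h) ((volume.restrict (Ioi (1 : ℝ))).prod ν) := by
    rw [integrable_prod_iff hmeas.aestronglyMeasurable]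
    constructor
    · refine ae_of_all _ fun t => ?_
      exact hi (max t 1) (hmax t)
    · refine (hD.neg).congr_fun (fun t ht => ?_) measurableSet_Ioi
      have : max t 1 = t := max_eq_left (le_of_lt ht)
      simp [h, this]
  filter_upwards [hint.prod_left_ae] with x hx
  refine IntegrableOn.congr_fun (f := fun t => h t x) hx (fun t ht => ?_) measurableSet_Ioi
  have : max t 1 = t := max_eq_left (le_of_lt ht)
  simp [h, this, hN]

/-- A function with bounded derivative and integrable square tends to zero. -/
lemma tendsto_zero_of_integrableOn_sq {g g' : ℝ → ℝ} {B C : ℝ}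
    (hg : ∀ t, 1 < t → HasDerivAt g (g' t) t) (hgB : ∀ t, 1 < t → |g t| ≤ B)
    (hg' : ∀ t, 1 < t → |g' t| ≤ C) (hi : IntegrableOn (fun t => g t ^ 2) (Ioi 1)) :
    Tendsto g atTop (𝓝 0) := by
  have hgc : ContinuousOn g (Ioi 1) := fun t ht => (hg t ht).continuousAt.continuousWithinAt
  -- Both `g³` and its derivative `3g²g'` are a bounded function times `g²`, hence integrable, which
  -- forces `g³ → 0`.
  have hi3 : IntegrableOn (fun t => g t ^ 3) (Ioi 1) := by
    have h1 : IntegrableOn (fun t => g t ^ 2 * g t) (Ioi 1) :=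
      Integrable.mul_bdd (c := B) hi (hgc.aestronglyMeasurable measurableSet_Ioi)
        ((ae_restrict_iff' measurableSet_Ioi).2 (ae_of_all _ hgB))
    exact h1.congr_fun (fun t _ => by ring) measurableSet_Ioi
  have hid : IntegrableOn (fun t => 3 * g t ^ 2 * deriv g t) (Ioi 1) := by
    refine Integrable.mul_bdd (c := C) (hi.const_mul 3)
      (measurable_deriv g).aestronglyMeasurable
      ((ae_restrict_iff' measurableSet_Ioi).2 (ae_of_all _ fun t ht => ?_))
    rw [(hg t ht).deriv]
    exact hg' t ht
  have h3 := tendsto_zero_of_hasDerivAt_of_integrableOn_Ioi (f := fun t => g t ^ 3)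
    (fun t ht => by
      have := (hg t ht).fun_pow 3
      rw [← (hg t ht).deriv] at this
      simpa using this) hid hi3
  rw [Metric.tendsto_nhds] at h3 ⊢
  intro ε hε
  filter_upwards [h3 (ε ^ 3) (by positivity)] with t ht
  rw [dist_zero_right, norm_pow] at ht
  rw [dist_zero_right]
  exact lt_of_pow_lt_pow_left₀ 3 hε.le ht

/-- After time 1 the universal bound controls both the net stress and its time derivative, so square
integrability in time implies decay. -/
lemma IsClassical.ae_tendsto_netStress (hp : IsClassical ν μ f p)
    (hm : ∀ t, 0 < t → Measurable fun x => p x t) :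
    ∀ᵐ x ∂ν, Tendsto (fun t => cubicStress (p x t) - ∫ y, cubicStress (p y t) ∂ν)
      atTop (𝓝 0) := by
  filter_upwards [hp.ae_integrableOn_sq hm] with x hx
  set N : ℝ → ℝ := fun t => ∫ y, cubicStress (p y t) ∂ν with hN
  set C := |μ| + 4 + 4 / 1
  have hpC : ∀ x t, 1 < t → |p x t| ≤ C := fun x t ht => hp.bound_of_le one_pos x ht.le
  obtain ⟨B, hB0, hB⟩ := exists_cubicStress_bound C
  obtain ⟨B', hB'0, hB'⟩ := exists_bound_of_continuous
    (by fun_prop : Continuous fun r : ℝ => 3 * r ^ 2 - 1) C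
  have hNB : ∀ x t, 1 < t → |N t - cubicStress (p x t)| ≤ B + B := fun x t ht =>
    (abs_sub _ _).trans
      (add_le_add (abs_integral_le fun y => hB _ (hpC y t ht)) (hB _ (hpC x t ht)))
  have hrate : ∀ x t, 1 < t →
      |(3 * p x t ^ 2 - 1) * (N t - cubicStress (p x t))| ≤ B' * (B + B) := by
    intro x t ht
    rw [abs_mul]
    have h1 := hB' _ (hpC x t ht)
    have h2 := hNB x t ht
    gcongr
  refine tendsto_zero_of_integrableOn_sq (B := B + B) (C := B' * (B + B) + B' * (B + B))
    (fun t ht => ((hasDerivAt_cubicStress (p x t)).comp t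
      (hp.deriv x t (one_pos.trans ht))).sub (hp.hasDerivAt_integral_comp hasDerivAt_cubicStress
        (by fun_prop) (one_pos.trans ht)))
    (fun t ht => by rw [abs_sub_comm]; exact hNB x t ht) (fun t ht => ?_) hx
  exact (abs_sub _ _).trans (add_le_add (hrate x t ht) (abs_integral_le fun y => hrate y t ht))

/-- Along a classical solution the second moment is asymptotically affine in the mean stress. -/
lemma IsClassical.exists_tendsto_second_moment (hp : IsClassical ν μ f p)
    (hg : ∀ᵐ x ∂ν, Tendsto (fun t => cubicStress (p x t) - ∫ y, cubicStress (p y t) ∂ν)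
      atTop (𝓝 0)) :
    ∃ K, Tendsto (fun t => ∫ x, p x t ^ 2 ∂ν - μ * ∫ y, cubicStress (p y t) ∂ν) atTop
      (𝓝 K) := by
  obtain ⟨W, hW⟩ := hp.exists_tendsto_energy
  set N : ℝ → ℝ := fun t => ∫ y, cubicStress (p y t) ∂ν with hN
  set C := |μ| + 4 + 4 / 1
  have hC0 : 0 ≤ C := by positivity
  have hpC : ∀ x t, 1 ≤ t → |p x t| ≤ C := fun x t ht => hp.bound_of_le one_pos x ht
  obtain ⟨B, hB0, hB⟩ := exists_cubicStress_bound C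
  have h0 : Tendsto (fun t => ∫ x, p x t * (cubicStress (p x t) - N t) ∂ν) atTop
      (𝓝 (∫ _, (0 : ℝ) ∂ν)) := by
    refine tendsto_integral_filter_of_dominated_convergence (fun _ => C * (B + B)) ?_ ?_
      (integrable_const _) ?_
    · filter_upwards [eventually_ge_atTop 1] with t ht
      have ht0 : 0 < t := one_pos.trans_le ht
      exact (hp.aesm t ht0).mul ((hp.aesm_stress ht0).sub aestronglyMeasurable_const)
    · filter_upwards [eventually_ge_atTop 1] with t ht
      refine ae_of_all _ fun x => ?_
      rw [norm_mul]
      exact mul_le_mul (hpC x t ht) ((abs_sub _ _).trans (add_le_add (hB _ (hpC x t ht))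
        (abs_integral_le fun y => hB _ (hpC y t ht)))) (norm_nonneg _) hC0
    · filter_upwards [hg] with x hx
      refine squeeze_zero_norm' ?_ (by simpa using hx.abs.const_mul C)
      filter_upwards [eventually_ge_atTop 1] with t ht
      rw [norm_mul]
      exact mul_le_mul_of_nonneg_right (hpC x t ht) (norm_nonneg _)
  -- Uses `r(σ(r) - N) - 4(r⁴/4 - r²/2) = r² - N r`; thus `K` is `-4` times the limiting energy.
  refine ⟨_, (h0.sub (hW.const_mul 4)).congr' ?_⟩
  filter_upwards [eventually_ge_atTop 1] with t ht
  have ht0 : 0 < t := one_pos.trans_le ht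
  have i1 : Integrable (fun x => p x t * (cubicStress (p x t) - N t)) ν :=
    hp.integrable_comp (φ := fun r => r * (cubicStress r - N t))
      (continuous_id.mul (continuous_cubicStress.sub continuous_const)) ht0
  have i2 : Integrable (fun x => p x t ^ 4 / 4 - p x t ^ 2 / 2) ν :=
    hp.integrable_comp (φ := fun r => r ^ 4 / 4 - r ^ 2 / 2) (by fun_prop) ht0
  rw [← integral_const_mul, ← integral_sub i1 (i2.const_mul 4)]
  change _ = ∫ x, p x t ^ 2 ∂ν - μ * N t
  rw [← hp.mean t ht0, ← integral_mul_const,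
    ← integral_sub (hp.integrable_comp (φ := fun r => r ^ 2) (by fun_prop) ht0)
      ((hp.integrable_comp (φ := fun r => r) continuous_id ht0).mul_const _)]
  refine integral_congr_ae (ae_of_all _ fun x => ?_)
  simp only [cubicStress]
  ring

/-- Without a limit, `N` would oscillate across some `[a, b]`. If `b > 0` this contradicts `μ ≠ 0`
directly; otherwise `-a > 0`, and the same argument applies to `-p`, whose mean is `-μ`. -/
lemma IsClassical.exists_tendsto_integral_stress (hp : IsClassical ν μ f p) (hμ : μ ≠ 0)
    (hm : ∀ t, 0 < t → Measurable fun x => p x t) :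
    ∃ s, Tendsto (fun t => ∫ y, cubicStress (p y t) ∂ν) atTop (𝓝 s) := by
  have hg := hp.ae_tendsto_netStress hm
  obtain ⟨K, hK⟩ := hp.exists_tendsto_second_moment hg
  have hpC : ∀ x t, 1 ≤ t → |p x t| ≤ |μ| + 4 + 4 / 1 := fun x t ht =>
    hp.bound_of_le one_pos x ht
  obtain ⟨B, hB0, hB⟩ := exists_cubicStress_bound (|μ| + 4 + 4 / 1)
  have hNc := hp.continuousOn_integral_stress
  set N : ℝ → ℝ := fun t => ∫ y, cubicStress (p y t) ∂ν with hN
  refine exists_tendsto_of_abs_le (C := B)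
    (fun t ht => abs_integral_le fun y => hB _ (hpC y t ht)) fun a b hab ha hb => ?_
  rcases lt_or_ge 0 b with hb0 | hb0
  · exact hμ (mean_eq_zero_of_oscillation hp.aesm hp.continuousOn hpC hp.mean hNc hg hK hab hb0
      ha hb)
  · refine hμ (neg_eq_zero.1 (mean_eq_zero_of_oscillation (p := fun x t => -p x t)
      (N := fun t => -N t) (K := K) (C := |μ| + 4 + 4 / 1) (a := -b) (b := -a)
      (fun t ht => (hp.aesm t ht).neg) (fun x => (hp.continuousOn x).neg)
      (fun x t ht => by rw [abs_neg]; exact hpC x t ht)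
      (fun t ht => by rw [integral_neg, hp.mean t ht]) hNc.neg ?_ ?_ (neg_lt_neg hab)
      (by linarith) ?_ ?_))
    · filter_upwards [hg] with x hx
      refine (neg_zero (G := ℝ) ▸ hx.neg).congr fun t => ?_
      rw [cubicStress_neg]
      ring
    · refine hK.congr fun t => ?_
      simp only [neg_sq, neg_mul_neg, hN]
    · exact hb.mono fun t ht => neg_lt_neg ht
    · exact ha.mono fun t ht => neg_lt_neg ht

/-- A classical solution with nonzero mean converges almost everywhere to an equilibrium. -/
theorem IsClassical.exists_limit (hp : IsClassical ν μ f p) (hμ : μ ≠ 0)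
    (hm : ∀ t, 0 < t → Measurable fun x => p x t) :
    ∃ q : α → ℝ, MemLp q 2 ν ∧ Integrable (fun x => cubicStress (q x)) ν ∧
      (∀ᵐ x ∂ν, 0 = -cubicStress (q x) + ∫ y, cubicStress (q y) ∂ν) ∧ ∫ x, q x ∂ν = μ ∧
      ∀ᵐ x ∂ν, Tendsto (fun t => p x t) atTop (𝓝 (q x)) := by
  obtain ⟨s, hs⟩ := hp.exists_tendsto_integral_stress hμ hm
  set C := |μ| + 4 + 4 / 1
  have hpC : ∀ x t, 1 ≤ t → |p x t| ≤ C := fun x t ht => hp.bound_of_le one_pos x ht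
  obtain ⟨B, hB0, hB⟩ := exists_cubicStress_bound C
  have hσ : ∀ᵐ x ∂ν, Tendsto (fun t => cubicStress (p x t)) atTop (𝓝 s) := by
    filter_upwards [hp.ae_tendsto_netStress hm] with x hx
    simpa using hx.add hs
  set q : α → ℝ := fun x => limUnder atTop (p x) with hq
  have hlim : ∀ᵐ x ∂ν, Tendsto (fun t => p x t) atTop (𝓝 (q x)) := by
    filter_upwards [hσ] with x hx
    exact tendsto_nhds_limUnder
      (exists_tendsto_of_tendsto_cubicStress (hp.continuousOn x) (hpC x) hx)
  have hqs : ∀ᵐ x ∂ν, cubicStress (q x) = s := by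
    filter_upwards [hσ, hlim] with x hx hx'
    exact tendsto_nhds_unique ((continuous_cubicStress.tendsto _).comp hx') hx
  have hqm : AEStronglyMeasurable q ν := by
    refine aestronglyMeasurable_of_tendsto_ae atTop (f := fun (n : ℕ) x => p x (n + 1))
      (fun n => hp.aesm _ (by positivity)) ?_
    filter_upwards [hlim] with x hx
    exact hx.comp (tendsto_atTop_add_const_right _ _ tendsto_natCast_atTop_atTop)
  have hqC : ∀ᵐ x ∂ν, ‖q x‖ ≤ C := by
    filter_upwards [hlim] with x hx
    refine le_of_tendsto hx.norm ?_
    filter_upwards [eventually_ge_atTop 1] with t ht using hpC x t ht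
  have hmean : ∫ x, q x ∂ν = μ := by
    have h : Tendsto (fun t => ∫ x, p x t ∂ν) atTop (𝓝 (∫ x, q x ∂ν)) := by
      refine tendsto_integral_filter_of_dominated_convergence (fun _ => C) ?_ ?_
        (integrable_const _) hlim
      · filter_upwards [eventually_gt_atTop 0] with t ht using hp.aesm t ht
      · filter_upwards [eventually_ge_atTop 1] with t ht using ae_of_all _ fun x => hpC x t ht
    refine tendsto_nhds_unique h (tendsto_const_nhds.congr' ?_)
    filter_upwards [eventually_gt_atTop 0] with t ht using (hp.mean t ht).symm
  have hqσ : ∫ y, cubicStress (q y) ∂ν = s := by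
    rw [integral_congr_ae hqs]
    simp
  refine ⟨q, MemLp.of_bound hqm C hqC, (integrable_const s).congr ?_, ?_, hmean, hlim⟩
  · filter_upwards [hqs] with x hx using hx.symm
  · filter_upwards [hqs] with x hx
    rw [hx, hqσ, neg_add_cancel]

end Asymptotics

end Visco

end

/-! ### Existence, uniqueness and convergence combined -/

theorem propositionp (μ : ℝ) (hμ : μ ≠ 0) (p₀ : ℝ → ℝ) (hp₀ : p₀ ∈ Visco.dataSpace μ) :
    ∃ p : ℝ → ℝ → ℝ,
      Visco.IsSolution Visco.cubicStress p₀ p ∧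
      (∀ q : ℝ → ℝ → ℝ, Visco.IsSolution Visco.cubicStress p₀ q →
        ∀ᵐ x ∂Visco.unitMeasure, ∀ t : ℝ, 0 ≤ t → q x t = p x t) ∧
      ∃ pbar : ℝ → ℝ, Visco.IsEquilibrium Visco.cubicStress μ pbar ∧
        ∀ᵐ x ∂Visco.unitMeasure, Tendsto (fun t : ℝ => p x t) atTop (𝓝 (pbar x)) := by
  obtain ⟨p, hp, hm⟩ := Visco.exists_isClassical hp₀.1 hp₀.2
  refine ⟨fun x t => if t = 0 then p₀ x else p x t, hp.isSolution hp₀.1, fun q hq => ?_, ?_⟩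
  · obtain ⟨r, hr, hrq⟩ := hq.exists_isClassical hp₀
    filter_upwards [hrq, hr.ae_eq hp₀.1.1 hp, hq.initial] with x h1 h2 h3 t ht
    rcases ht.eq_or_lt with rfl | ht
    · simpa using h3
    · simp [ht.ne', ← h1, h2 t ht]
  · obtain ⟨pbar, h1, h2, h3, h4, h5⟩ := hp.exists_limit hμ hm
    refine ⟨pbar, ⟨h1, h2, h3, h4⟩, ?_⟩
    filter_upwards [h5] with x hx
    refine hx.congr' ?_
    filter_upwards [eventually_gt_atTop 0] with t ht
    simp [ht.ne']
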